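/- Let $G$ be a finite group and $K\le G$ a subgroup, and put one qudit with basis $\{|g\rangle : g\in G\}$ on every oriented edge of a lattice. On an edge let $L_+^h|g\rangle=|hg\rangle$, $L_-^h|g\rangle=|gh^{-1}\rangle$, $T_+^h|g\rangle=\delta_{h,g}|g\rangle$, $T_-^h|g\rangle=\delta_{h^{-1},g}|g\rangle$. **Local operators.** At a cilium $s=(v,p)$ (a plaquette $p$ with a vertex $v$ that occurs once on its boundary) let $A^g(s)$ be the product of the $L^g_\pm$ over the edges at $v$ ($L_-$ on edges starting at $v$, $L_+$ on edges ending at $v$) and $B^h(s)=\sum_{h_1\cdots h_m=h}\prod_i T^{h_i}(j_i)$, where $j_1,\dots,j_m$ are the boundary edges of $p$ in counterclockwise order from $v$ ($T_-$ if $p$ is on the left of the edge, $T_+$ otherwise). For $hK\in G/K$, $k\in K$ put $Z^{(hK,k)}(s)=\sum_{j\in hK}B^j(s)\,A^k(s)$. Let $\mathcal Z=Z(G,1,K,1)$ be the algebra with basis $Z^{(hK,k)}$ and product $Z^{(h_1K,k_1)}Z^{(h_2K,k_2)}=\delta_{h_1K,\,k_1h_2K}\,Z^{(h_1K,k_1k_2)}$.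 **Boundary ribbon operators.** For $hK\in G/K$, $k\in K$ put $Y_\tau^{(hK,k)}=\delta_{1,k}\frac1{|K|}\sum_{j\in hK}L^j_\pm(e)$ on a dual triangle $\tau$ over an edge $e$, $Y_{\tau'}^{(hK,k)}=T^k_\pm(e')$ on a direct triangle $\tau'$ over $e'$ (signs given by the orientation of the edge), $Y_\epsilon^{(hK,k)}=\delta_{1,k}$ on the trivial ribbon, and $Y^{(hK,k)}_{\rho_1\rho_2}=\sum_{j\in K}Y^{(hK,j)}_{\rho_1}Y^{(j^{-1}hK,\,j^{-1}k)}_{\rho_2}$. Let $\mathcal Y=Y(G,K)$ be the dual space of $\mathcal Z$, with the basis $Y^{(hK,k)}$ dual to $Z^{(hK,k)}$; the product of $\mathcal Z$ is dual to the gluing relation. A local operator $z\in\mathcal Z$ acts on $y\in\mathcal Y$ at the last and at the first cilium of a ribbon by $\langle z\triangleright y,w\rangle=\langle y,wz\rangle$ and $\langle y\triangleleft z,w\rangle=\langle y,zw\rangle$ respectively. **Elementary excitations.** An *elementary excitation* of the boundary is a nonzero subspace of $\mathcal Y$ that is preserved by the local operators at both ends of the ribbon and is not the direct sum of two nonzero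 such subspaces; its *quantum dimension* is the square root of the dimension of this subspace. An *elementary excitation at the last cilium* is defined in the same way with only the local operators at the last cilium; two of them have the same *topological charge* if there is a linear isomorphism between them that commutes with these local operators. **Labels.** Choose a representative $r_T$ of every double coset $T\in K\backslash G/K$, put $K^{r_T}=K\cap r_TKr_T^{-1}$, and choose representatives $Q=\{q_i\}$ of $K/K^{r_T}$ and a matrix form $\Gamma_R$ of every irreducible complex representation $R$ of $K^{r_T}$ (up to isomorphism). With $s_i=q_ir_Tq_i^{-1}$, $\mathbf u=(i,j)$, $\mathbf v=(i',j')$ ($1\le i,i'\le|Q|$, $1\le j,j'\le\dim R$) let $$Y^{(T,R);(\mathbf u,\mathbf v)}=\frac{\dim R}{|K^{r_T}|}\sum_{k\in K^{r_T}}\bigl(\Gamma_R^{-1}(k)\bigr)_{jj'}\,Y^{(s_iK,\;q_ikq_{i'}^{-1})}.$$ **Theorem.** For all such choices: 1. At every cilium $s$, $Z^{(hK,k)}\mapsto Z^{(hK,k)}(s)$ is an injective unital homomorphism from $\mathcal Z$ to the operators on the lattice. On every ribbon $\rho$ whose triangles lie over pairwise different edges and which has a dual and a direct triangle, the linear map $Y^{(hK,k)}\mapsto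 Y^{(hK,k)}_\rho$ is injective on $\mathcal Y$. 2. The elements $Y^{(T,R);(\mathbf u,\mathbf v)}$, for all $(T,R)$, $\mathbf u$, $\mathbf v$, form a basis of $\mathcal Y$. 3. $(T,R)\mapsto \operatorname{span}\{Y^{(T,R);(\mathbf u,\mathbf v)}:\mathbf u,\mathbf v\}$ is a bijection from the pairs $(T,R)$, where $T\in K\backslash G/K$ and $R$ is an irreducible representation of $K^{r_T}$ up to isomorphism, to the elementary excitations of the boundary. 4. For all $(T,R)$, $i$, $j'$ the space $V^{(T,R)}_{i,j'}=\operatorname{span}\{Y^{(T,R);((i,j),(i',j'))}:i',j\}$ is an elementary excitation at the last cilium. Every elementary excitation at the last cilium has, for exactly one pair $(T,R)$, the same topological charge as the $V^{(T,R)}_{i,j'}$ (for that pair, as all of them). 5. The quantum dimension of the elementary excitation $(T,R)$ is $\operatorname{FPdim}(T,R)=|Q|\dim R=\dfrac{|K|\dim R}{|K^{r_T}|}$, and $\dim V^{(T,R)}_{i,j'}=|Q|\dim R$. -/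

import Mathlib

noncomputable section

namespace KitaevBoundary

open Classical

/-! ### The lattice: qudits on edges and the elementary edge operators

`E` is the set of (oriented) edges of the lattice. A basis ket is a colouring `x : E → G`. -/

/-- The state space of all edge qudits, with basis the kets `|x⟩`, `x : E → G`
(for finite `E` this is `⨂_{e ∈ E} ℂ[G]`). -/
abbrev LatticeState (E G : Type*) := (E → G) →₀ ℂ

/-- Linear operators on the state space. -/
abbrev Op (E G : Type*) := Module.End ℂ (LatticeState E G)

section Lattice

variable {E G : Type*} [Group G] [Fintype G]

/-- The linear operator that sends the ket `|x⟩` to `φ x`. -/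
def opOfKets (φ : (E → G) → LatticeState E G) : Op E G :=
  Finsupp.linearCombination ℂ φ

/-- `L₊^g` at the edge `e`: `|x⟩ ↦ |g x⟩`. -/
def Lplus (e : E) (g : G) : Op E G :=
  opOfKets fun x => Finsupp.single (Function.update x e (g * x e)) 1

/-- `L₋^g` at the edge `e`: `|x⟩ ↦ |x g⁻¹⟩`. -/
def Lminus (e : E) (g : G) : Op E G :=
  opOfKets fun x => Finsupp.single (Function.update x e (x e * g⁻¹)) 1

/-- `T₊^h` at the edge `e`: `|x⟩ ↦ δ_{h,x} |x⟩`. -/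
def Tplus (e : E) (h : G) : Op E G :=
  opOfKets fun x => if x e = h then Finsupp.single x 1 else 0

/-- `T₋^h` at the edge `e`: `|x⟩ ↦ δ_{h⁻¹,x} |x⟩`. -/
def Tminus (e : E) (h : G) : Op E G :=
  opOfKets fun x => if x e = h⁻¹ then Finsupp.single x 1 else 0

/-! ### Cilia and local operators -/

/-- The lattice around a cilium `s = (v, p)`, where `p` is a plaquette and `v` a vertex of `p`.
The boundary of `p`, read counterclockwise from `v`, is `first, mid, last`, where the flag of an
edge is `true` when the edge is directed along that reading (so that `p` is on its left).
The edges at `v` are `first`, `last` and those of `rest`, where the flag of an edge of `rest` is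
`true` when `v` is its origin. On the square lattice `mid` and `rest` have two entries each. -/
structure Cilium (E : Type*) where
  first : E × Bool
  mid : List (E × Bool)
  last : E × Bool
  rest : List (E × Bool)
  nodup : (((first :: mid) ++ [last] ++ rest).map Prod.fst).Nodup

/-- The boundary of the plaquette, counterclockwise from the vertex. -/
def Cilium.boundary (s : Cilium E) : List (E × Bool) := (s.first :: s.mid) ++ [s.last]

/-- The edges at the vertex `v`; the flag says whether `v` is the origin of the edge.
(`v` is the origin of `first` when `first` is directed along the boundary of `p`, and the origin
of `last` when `last` is directed against it.) -/
def Cilium.star (s : Cilium E) : List (E × Bool) :=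
  s.first :: (s.last.1, !s.last.2) :: s.rest

/-- The vertex operator `A^g(v) = ∏_{j ∈ star(v)} L^g(j, v)`, with `L₋` on edges that start
at `v` and `L₊` on edges that end at `v`. -/
def vertexOp (s : Cilium E) (g : G) : Op E G :=
  (s.star.map fun j => if j.2 then Lminus j.1 g else Lplus j.1 g).prod

/-- `∑_{h₁ ⋯ hₘ = h} T^{h₁}(j₁) ⋯ T^{hₘ}(jₘ)` along a list of edges, with `T₋` on edges that are
directed along the reading (flag `true`) and `T₊` on the others. -/
def holonomyOp : List (E × Bool) → G → Op E G
  | [], h => if h = 1 then 1 else 0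
  | j :: l, h => ∑ g : G, (if j.2 then Tminus j.1 g else Tplus j.1 g) * holonomyOp l (g⁻¹ * h)

/-- The plaquette operator `B^h(v, p)`. -/
def plaquetteOp (s : Cilium E) (h : G) : Op E G := holonomyOp s.boundary h

variable {K : Subgroup G}

/-- The local operator `Z^{(hK,k)}(s) = B^{hK}(s) A^k(s)`, where `B^{hK} = ∑_{j ∈ hK} B^j`. -/
def localOp (s : Cilium E) (c : G ⧸ K) (k : K) : Op E G :=
  (∑ j : G with (QuotientGroup.mk j : G ⧸ K) = c, plaquetteOp s j) * vertexOp s (k : G)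

/-! ### Ribbons and boundary ribbon operators -/

/-- A dual or direct triangle over an edge `e` of the lattice. The flag tells which of the
operators `L₊`, `L₋` (dual), resp. `T₊`, `T₋` (direct), the orientation of `e` selects:
`true` is `+`. -/
inductive Triangle (E : Type*) where
  | dual (e : E) (pos : Bool)
  | direct (e : E) (pos : Bool)

/-- The edge of a triangle. -/
def Triangle.edge : Triangle E → E
  | .dual e _ => e
  | .direct e _ => e

/-- The boundary triangle operators: `Y_τ^{(hK,k)} = δ_{1,k} L^{hK}(e)` on a dual triangle, with
`L^{hK} = |hK|⁻¹ ∑_{j ∈ hK} L^j`, and `Y_τ^{(hK,k)} = T^k(e)` on a direct one. -/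
def triangleOp (c : G ⧸ K) (k : K) : Triangle E → Op E G
  | .dual e pos =>
      if k = 1 then
        ((Nat.card K : ℂ)⁻¹) • ∑ j : G with (QuotientGroup.mk j : G ⧸ K) = c,
          (if pos then Lplus e j else Lminus e j)
      else 0
  | .direct e pos => if pos then Tplus e (k : G) else Tminus e (k : G)

/-- The boundary ribbon operators `Y_ρ^{(hK,k)}` on a strip of triangles, from `Y_ε^{(hK,k)} =
δ_{1,k}` on the trivial ribbon and the gluing relation
`Y_{τρ}^{(hK,k)} = ∑_{j ∈ K} Y_τ^{(hK,j)} Y_ρ^{(j⁻¹hK, j⁻¹k)}`. -/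
def ribbonOp : List (Triangle E) → G ⧸ K → K → Op E G
  | [], _, k => if k = 1 then 1 else 0
  | τ :: ρ, c, k => ∑ j : K, triangleOp c j τ * ribbonOp ρ (j⁻¹ • c) (j⁻¹ * k)

/-- The gluing relation holds for every way to cut a ribbon in two. -/
theorem ribbonOp_append (ρ₁ ρ₂ : List (Triangle E)) (c : G ⧸ K) (k : K) :
    ribbonOp (ρ₁ ++ ρ₂) c k =
      ∑ j : K, ribbonOp ρ₁ c j * ribbonOp ρ₂ (j⁻¹ • c) (j⁻¹ * k) := by
  induction ρ₁ generalizing c k with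
  | nil => simp [ribbonOp]
  | cons τ ρ ih =>
    simp only [List.cons_append, ribbonOp, ih, Finset.mul_sum, Finset.sum_mul]
    symm
    rw [Finset.sum_comm]
    refine Finset.sum_congr rfl fun j _ => ?_
    refine Fintype.sum_equiv (Equiv.mulLeft j⁻¹) _ _ fun i => ?_
    simp [mul_assoc, mul_smul]

/-- A ribbon with both kinds of triangles that does not intersect itself. -/
structure IsBoundaryRibbon (ρ : List (Triangle E)) : Prop where
  nodup : (ρ.map Triangle.edge).Nodup
  exists_dual : ∃ e pos, Triangle.dual e pos ∈ ρ
  exists_direct : ∃ e pos, Triangle.direct e pos ∈ ρ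

end Lattice

section Algebra

variable {G : Type*} [Group G]

/-! ### The algebra `Z(G,1,K,1)` of local operators -/

/-- The space `Z(G,1,K,1) = F[G/K] ⊗ ℂ[K]`; an element is the family of its coefficients with
respect to the basis `Z^{(hK,k)}`. -/
def LocalAlgebra (K : Subgroup G) : Type _ := (G ⧸ K) × K → ℂ

variable {K : Subgroup G}

instance : AddCommGroup (LocalAlgebra K) := inferInstanceAs (AddCommGroup ((G ⧸ K) × K → ℂ))

instance : Module ℂ (LocalAlgebra K) := inferInstanceAs (Module ℂ ((G ⧸ K) × K → ℂ))

/-- The basis element `Z^{(hK,k)}`. -/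
def zElt (c : G ⧸ K) (k : K) : LocalAlgebra K := fun p => if p = (c, k) then 1 else 0

theorem LocalAlgebra.add_apply (z w : LocalAlgebra K) (p : (G ⧸ K) × K) :
    (z + w) p = z p + w p := rfl

theorem LocalAlgebra.zero_apply (p : (G ⧸ K) × K) : (0 : LocalAlgebra K) p = 0 := rfl

theorem LocalAlgebra.smul_apply (a : ℂ) (z : LocalAlgebra K) (p : (G ⧸ K) × K) :
    (a • z) p = a * z p := rfl

@[ext] theorem LocalAlgebra.ext {z w : LocalAlgebra K} (h : ∀ p, z p = w p) : z = w := funext h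

/-- The unit `∑_{hK} Z^{(hK,1)}`. -/
instance : One (LocalAlgebra K) := ⟨fun p => if p.2 = 1 then 1 else 0⟩

theorem LocalAlgebra.one_apply (p : (G ⧸ K) × K) :
    (1 : LocalAlgebra K) p = if p.2 = 1 then 1 else 0 := rfl

variable [Fintype G]

/-- The bilinear extension of `Z^{(h₁K,k₁)} Z^{(h₂K,k₂)} = δ_{h₁K, k₁h₂K} Z^{(h₁K,k₁k₂)}`
(see `zElt_mul_zElt`). -/
instance : Mul (LocalAlgebra K) :=
  ⟨fun z w p => ∑ j : K, z (p.1, j) * w (j⁻¹ • p.1, j⁻¹ * p.2)⟩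

theorem LocalAlgebra.mul_apply (z w : LocalAlgebra K) (p : (G ⧸ K) × K) :
    (z * w) p = ∑ j : K, z (p.1, j) * w (j⁻¹ • p.1, j⁻¹ * p.2) := rfl

instance : Ring (LocalAlgebra K) :=
  { (inferInstance : AddCommGroup (LocalAlgebra K)),
    (inferInstance : Mul (LocalAlgebra K)),
    (inferInstance : One (LocalAlgebra K)) with
    left_distrib := fun a b c => by
      ext p
      simp only [LocalAlgebra.mul_apply, LocalAlgebra.add_apply, mul_add, Finset.sum_add_distrib]
    right_distrib := fun a b c => by
      ext p
      simp only [LocalAlgebra.mul_apply, LocalAlgebra.add_apply, add_mul, Finset.sum_add_distrib]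
    zero_mul := fun a => by
      ext p
      simp [LocalAlgebra.mul_apply, LocalAlgebra.zero_apply]
    mul_zero := fun a => by
      ext p
      simp [LocalAlgebra.mul_apply, LocalAlgebra.zero_apply]
    one_mul := fun a => by
      ext p
      simp [LocalAlgebra.mul_apply, LocalAlgebra.one_apply]
    mul_one := fun a => by
      ext p
      simp [LocalAlgebra.mul_apply, LocalAlgebra.one_apply, inv_mul_eq_one]
    mul_assoc := fun a b c => by
      ext p
      simp only [LocalAlgebra.mul_apply, Finset.sum_mul, Finset.mul_sum]
      rw [Finset.sum_comm]
      refine Finset.sum_congr rfl fun j _ => ?_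
      refine Fintype.sum_equiv (Equiv.mulLeft j⁻¹) _ _ fun i => ?_
      simp [mul_assoc, mul_smul] }

instance : Algebra ℂ (LocalAlgebra K) :=
  Algebra.ofModule
    (fun a z w => by
      ext p
      simp only [LocalAlgebra.mul_apply, LocalAlgebra.smul_apply, Finset.mul_sum, mul_assoc])
    (fun a z w => by
      ext p
      simp only [LocalAlgebra.mul_apply, LocalAlgebra.smul_apply, Finset.mul_sum]
      exact Finset.sum_congr rfl fun _ _ => mul_left_comm _ _ _)

/-- The product of basis elements. -/
theorem zElt_mul_zElt (c₁ c₂ : G ⧸ K) (k₁ k₂ : K) :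
    zElt c₁ k₁ * zElt c₂ k₂ = if c₁ = k₁ • c₂ then zElt c₁ (k₁ * k₂) else 0 := by
  ext ⟨c, k⟩
  rw [LocalAlgebra.mul_apply, Finset.sum_eq_single k₁]
  · by_cases hc : c = c₁
    · subst hc
      by_cases h : c = k₁ • c₂
      · subst h
        simp [zElt, inv_mul_eq_iff_eq_mul]
      · simp [zElt, h, inv_smul_eq_iff, LocalAlgebra.zero_apply]
    · have h0 : zElt c₁ k₁ (c, k₁) = 0 := by simp [zElt, hc]
      rw [h0, zero_mul]
      split_ifs
      · simp [zElt, hc]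
      · rfl
  · intro j _ hj
    simp [zElt, hj]
  · simp

/-! ### The coalgebra `Y(G,K)` of boundary ribbon operators -/

/-- The space `Y(G,K) = ℂ[G/K] ⊗ F[K]` of boundary ribbon operators, dual to `Z(G,1,K,1)`. -/
abbrev RibbonAlgebra (K : Subgroup G) : Type _ := Module.Dual ℂ (LocalAlgebra K)

/-- The basis element `Y^{(hK,k)}`, dual to `Z^{(hK,k)}`. -/
def yElt (c : G ⧸ K) (k : K) : RibbonAlgebra K where
  toFun z := z (c, k)
  map_add' _ _ := rfl
  map_smul' _ _ := rfl

theorem yElt_apply (c : G ⧸ K) (k : K) (z : LocalAlgebra K) : yElt c k z = z (c, k) := rfl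

theorem yElt_apply_zElt (c c' : G ⧸ K) (k k' : K) :
    yElt c k (zElt c' k') = if (c, k) = (c', k') then 1 else 0 := rfl

/-- The product of `Z(G,1,K,1)` is dual to the gluing relation
`Y^{(hK,k)} ↦ ∑_{j ∈ K} Y^{(hK,j)} ⊗ Y^{(j⁻¹hK, j⁻¹k)}`. -/
theorem yElt_apply_mul (c : G ⧸ K) (k : K) (z w : LocalAlgebra K) :
    yElt c k (z * w) = ∑ j : K, yElt c j z * yElt (j⁻¹ • c) (j⁻¹ * k) w := rfl

/-- The action of a local operator at the last cilium `s₁` of the ribbon: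
`⟨z ▷ y, w⟩ = ⟨y, w z⟩`. -/
def actEnd (z : LocalAlgebra K) (y : RibbonAlgebra K) : RibbonAlgebra K :=
  y ∘ₗ LinearMap.mulRight ℂ z

/-- The action of a local operator at the first cilium `s₀` of the ribbon:
`⟨y ◁ z, w⟩ = ⟨y, z w⟩`. -/
def actStart (z : LocalAlgebra K) (y : RibbonAlgebra K) : RibbonAlgebra K :=
  y ∘ₗ LinearMap.mulLeft ℂ z

/-- `Z^{(gK,m)} ▷ Y^{(hK,k)} = δ_{gK, m k⁻¹ h K} Y^{(hK, k m⁻¹)}`. -/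
theorem actEnd_zElt_yElt (b c : G ⧸ K) (m k : K) :
    actEnd (zElt b m) (yElt c k) =
      if b = (m * k⁻¹) • c then yElt c (k * m⁻¹) else 0 := by
  ext z
  change (z * zElt b m) (c, k) = _
  rw [LocalAlgebra.mul_apply, Finset.sum_eq_single (k * m⁻¹)]
  · by_cases h : b = (m * k⁻¹) • c
    · simp [zElt, h, yElt_apply]
    · simp [zElt, h, eq_comm]
  · intro j _ hj
    have : j⁻¹ * k ≠ m := fun h => hj (by rw [← h]; group)
    simp [zElt, this]
  · simp

/-- `Y^{(hK,k)} ◁ Z^{(gK,m)} = δ_{gK, hK} Y^{(m⁻¹hK, m⁻¹k)}`. -/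
theorem actStart_zElt_yElt (b c : G ⧸ K) (m k : K) :
    actStart (zElt b m) (yElt c k) =
      if b = c then yElt (m⁻¹ • c) (m⁻¹ * k) else 0 := by
  ext z
  change (zElt b m * z) (c, k) = _
  rw [LocalAlgebra.mul_apply, Finset.sum_eq_single m]
  · by_cases h : b = c
    · simp [zElt, h, yElt_apply]
    · simp [zElt, h, Ne.symm h]
  · intro j _ hj
    simp [zElt, hj]
  · simp

/-! ### The operators on the lattice that elements of `Z` and `Y` stand for -/

/-- The linear map `Z^{(hK,k)} ↦ Z^{(hK,k)}(s)`. -/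
def localMap {E : Type*} (K : Subgroup G) (s : Cilium E) : LocalAlgebra K →ₗ[ℂ] Op E G where
  toFun z := ∑ p : (G ⧸ K) × K, z p • localOp s p.1 p.2
  map_add' z w := by
    simp only [LocalAlgebra.add_apply, add_smul, Finset.sum_add_distrib]
  map_smul' a z := by
    simp only [LocalAlgebra.smul_apply, mul_smul, Finset.smul_sum, RingHom.id_apply]

/-- The linear map `Y^{(hK,k)} ↦ Y_ρ^{(hK,k)}`. -/
def ribbonMap {E : Type*} (K : Subgroup G) (ρ : List (Triangle E)) :
    RibbonAlgebra K →ₗ[ℂ] Op E G where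
  toFun y := ∑ p : (G ⧸ K) × K, y (zElt p.1 p.2) • ribbonOp ρ p.1 p.2
  map_add' y y' := by
    simp only [LinearMap.add_apply, add_smul, Finset.sum_add_distrib]
  map_smul' a y := by
    simp only [LinearMap.smul_apply, smul_eq_mul, mul_smul, Finset.smul_sum, RingHom.id_apply]

theorem localMap_zElt {E : Type*} (s : Cilium E) (c : G ⧸ K) (k : K) :
    localMap K s (zElt c k) = localOp s c k := by
  simp [localMap, zElt]

theorem ribbonMap_yElt {E : Type*} (ρ : List (Triangle E)) (c : G ⧸ K) (k : K) :
    ribbonMap K ρ (yElt c k) = ribbonOp ρ c k := by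
  simp [ribbonMap, yElt_apply_zElt]

/-! ### Elementary excitations -/

/-- `W` is preserved by the local operators at both ends of the ribbon. -/
def IsLocallyStable (W : Submodule ℂ (RibbonAlgebra K)) : Prop :=
  ∀ z : LocalAlgebra K, ∀ y ∈ W, actEnd z y ∈ W ∧ actStart z y ∈ W

/-- `W` is preserved by the local operators at the last cilium of the ribbon. -/
def IsStableAtEnd (W : Submodule ℂ (RibbonAlgebra K)) : Prop :=
  ∀ z : LocalAlgebra K, ∀ y ∈ W, actEnd z y ∈ W

/-- `W` is a nonzero subspace with the property `P` which is not the direct sum of two nonzero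
subspaces with the property `P`. -/
def IsIndecomposableFor {V : Type*} [AddCommGroup V] [Module ℂ V] (P : Submodule ℂ V → Prop)
    (W : Submodule ℂ V) : Prop :=
  W ≠ ⊥ ∧ P W ∧ ∀ W₁ W₂, P W₁ → P W₂ → W₁ ⊔ W₂ = W → W₁ ⊓ W₂ = ⊥ → W₁ = ⊥ ∨ W₂ = ⊥

/-- An elementary excitation of the boundary, as a space of ribbon operators: preserved by the
local operators at the two ends of the ribbon, and indecomposable as such. -/
def IsElementaryExcitation (W : Submodule ℂ (RibbonAlgebra K)) : Prop :=
  IsIndecomposableFor IsLocallyStable W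

/-- An elementary excitation at the last cilium `s` of the ribbon: a space of excitations
preserved by the local operators at `s`, and indecomposable as such. -/
def IsElementaryExcitationAtEnd (W : Submodule ℂ (RibbonAlgebra K)) : Prop :=
  IsIndecomposableFor IsStableAtEnd W

/-- Two spaces of excitations at the last cilium have the same topological charge: there is a
linear isomorphism that commutes with the local operators at that cilium. -/
def SameCharge (W W' : Submodule ℂ (RibbonAlgebra K)) : Prop :=
  ∃ φ : W ≃ₗ[ℂ] W', ∀ (z : LocalAlgebra K) (y y' : W),
    (y' : RibbonAlgebra K) = actEnd z y → (φ y' : RibbonAlgebra K) = actEnd z (φ y)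

/-- The quantum dimension of an elementary excitation is the square root of the dimension of its
space of ribbon operators. -/
def quantumDim (W : Submodule ℂ (RibbonAlgebra K)) : ℝ := Real.sqrt (Module.finrank ℂ W)

end Algebra

/-! ### Labels `(T,R)` and the Fourier basis -/

/-- An irreducible complex matrix representation of `H`. -/
structure MatrixIrrep (H : Type*) [Group H] where
  dim : ℕ
  rep : Representation ℂ H (Fin dim → ℂ)
  irreducible : rep.IsIrreducible

/-- The matrix `Γ(k)`. -/
def MatrixIrrep.matrix {H : Type*} [Group H] (Γ : MatrixIrrep H) (k : H) :
    Matrix (Fin Γ.dim) (Fin Γ.dim) ℂ :=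
  LinearMap.toMatrix' (Γ.rep k)

/-- Isomorphism of representations. -/
instance MatrixIrrep.setoid (H : Type*) [Group H] : Setoid (MatrixIrrep H) where
  r Γ Γ' := Nonempty (Representation.Equiv Γ.rep Γ'.rep)
  iseqv :=
    { refl := fun _ => ⟨.refl _⟩
      symm := fun ⟨e⟩ => ⟨e.symm⟩
      trans := fun ⟨e⟩ ⟨e'⟩ => ⟨e.trans e'⟩ }

/-- The set `H_ir` of isomorphism classes of irreducible representations of a finite group. -/
def IrrClass (H : Type*) [Group H] : Type _ := Quotient (MatrixIrrep.setoid H)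

variable {G : Type*} [Group G]

/-- `K^r = K ∩ r K r⁻¹`, as a subgroup of `K`. -/
def stab (K : Subgroup G) (r : G) : Subgroup K :=
  (K ⊓ K.map (MulAut.conj r).toMonoidHom).subgroupOf K

/-- The choices made in the Fourier transform: a representative `r_T` of each double coset `T`,
a set `Q` of representatives of `K / K^{r_T}`, and a matrix form of each irreducible
representation of `K^{r_T}`. -/
structure FourierChoice (K : Subgroup G) where
  r : DoubleCoset.Quotient (K : Set G) (K : Set G) → G
  mk_r : ∀ T, DoubleCoset.mk K K (r T) = T
  q : ∀ T, K ⧸ stab K (r T) → K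
  mk_q : ∀ T i, (QuotientGroup.mk (q T i) : K ⧸ stab K (r T)) = i
  Γ : ∀ T, IrrClass (stab K (r T)) → MatrixIrrep (stab K (r T))
  mk_Γ : ∀ T R, (Quotient.mk _ (Γ T R) : IrrClass (stab K (r T))) = R

instance (K : Subgroup G) : Nonempty (FourierChoice K) :=
  ⟨{  r := Quotient.out
      mk_r := fun T => Quotient.out_eq T
      q := fun _ => Quotient.out
      mk_q := fun _ i => Quotient.out_eq i
      Γ := fun _ => Quotient.out
      mk_Γ := fun _ R => Quotient.out_eq R }⟩

namespace FourierChoice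

variable {K : Subgroup G} (C : FourierChoice K)

/-- The pairs `(T, R)` of a double coset `T ∈ K\G/K` and an irreducible representation `R` of
`K^{r_T}`, up to isomorphism. -/
abbrev Label : Type _ :=
  Σ T : DoubleCoset.Quotient (K : Set G) (K : Set G), IrrClass (stab K (C.r T))

variable {C}

/-- The dimension of `R`. -/
def dimR (x : C.Label) : ℕ := (C.Γ x.1 x.2).dim

/-- The subgroup `K^{r_T}`. -/
abbrev stabT (x : C.Label) : Subgroup K := stab K (C.r x.1)

/-- The index set of the `u = (i, j)`, `1 ≤ i ≤ |Q|`, `1 ≤ j ≤ dim R`. -/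
abbrev Idx (x : C.Label) : Type _ := (K ⧸ stabT x) × Fin (dimR x)

/-- `s_i = q_i r_T q_i⁻¹`. -/
def sElt (x : C.Label) (i : K ⧸ stabT x) : G :=
  (C.q x.1 i : G) * C.r x.1 * (C.q x.1 i : G)⁻¹

open Classical in
/-- The Fourier transformed ribbon operator, for `u = (i, j)` and `v = (i', j')`,
`Y^{(T,R);(u,v)} = (dim R / |K^{r_T}|) ∑_{k ∈ K^{r_T}} (Γ_R⁻¹(k))_{jj'} Y^{(s_i K, q_i k q_{i'}⁻¹)}`. -/
def fourier [Fintype G] (x : C.Label) (u v : Idx x) : RibbonAlgebra K :=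
  ((dimR x : ℂ) / (Nat.card (stabT x) : ℂ)) •
    ∑ k : stabT x, ((C.Γ x.1 x.2).matrix k)⁻¹ u.2 v.2 •
      yElt (QuotientGroup.mk (sElt x u.1) : G ⧸ K) (C.q x.1 u.1 * (k : K) * (C.q x.1 v.1)⁻¹)

/-- The span of all `Y^{(T,R);(u,v)}` with given `(T,R)`. -/
def block [Fintype G] (x : C.Label) : Submodule ℂ (RibbonAlgebra K) :=
  Submodule.span ℂ (Set.range fun p : Idx x × Idx x => fourier x p.1 p.2)

/-- The span of the `Y^{(T,R);((i,j),(i',j'))}` with given `(T,R)`, `i` and `j'`. -/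
def endBlock [Fintype G] (x : C.Label) (i : K ⧸ stabT x) (j' : Fin (dimR x)) :
    Submodule ℂ (RibbonAlgebra K) :=
  Submodule.span ℂ (Set.range fun p : Idx x => fourier x (i, p.2) (p.1, j'))

end FourierChoice

end KitaevBoundary

end

open KitaevBoundary

noncomputable section
namespace KitaevBoundary
open Classical

/-! ### Local operators on kets: gauge transformations, holonomies, faithfulness -/

section Lattice

variable {E G : Type*}

/-! The algebra `LocalAlgebra K` is the convolution algebra of the action groupoid of `K` on `G ⧸
K`: `Z^{(hK,k)}` is the arrow `k` from `k⁻¹hK` to `hK`, and the product is composition. The orbits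
are the double cosets `T`, and the isotropy group at `r_T K` is `K^{r_T}`. The arrows `q_i` from
`r_T K` to `s_i K` trivialise each orbit, so that the algebra is the direct sum over `T` of the `|Q|
× |Q|` matrices over `ℂ[K^{r_T}]`. Decomposing these group algebras by Schur orthogonality and
Maschke's theorem turns it into a direct sum of full matrix algebras of size `|Q| dim R`, one for
each `(T,R)`. The isomorphism is made explicit by `matrixUnit`: the multiplication rules are
`matrixUnit_mul` and `matrixUnit_mul_of_ne`, and `eq_zero_of_matrixUnit` says that the matrix units
span.

On the dual space the actions at the last and the first cilium are the transposes of right and left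
multiplication. Up to scalars, and to an exchange of the representation indices, the Fourier
elements are the basis dual to the matrix units (`fourier_matrixUnit`). Hence `block x` consists of
the functionals supported on one matrix block, a simple bimodule of dimension `(|Q| dim R)²`, and
`endBlock x i j'` of those supported on a single row, a simple module of dimension `|Q| dim R`. The
classification uses that matrix units cut functionals down to single entries (`block_le`,
`endBlock_le`) and that every indecomposable submodule is simple, which is obtained by explicit
complements (`exists_eq_block`, `eq_zero_of_row`).

The realisation on the lattice is a matter of matrix elements between kets. A vertex operator is a
free gauge action, which conjugates the holonomy read by the plaquette operator; modulo `K`,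
conjugation by an element of `K` is left translation, and this is the groupoid product. For a
ribbon, two kets determine at most one label `(hK,k)` with a nonzero matrix element, and each label
occurs for some pair of kets. -/

theorem opOfKets_single (φ : (E → G) → LatticeState E G) (x : E → G) :
    opOfKets φ (Finsupp.single x 1) = φ x := by
  simp [opOfKets]

theorem op_ext {A B : Op E G}
    (h : ∀ x : E → G, A (Finsupp.single x 1) = B (Finsupp.single x 1)) : A = B := by
  ext1 x
  ext1
  exact h x

variable [Group G]

/-! ### The vertex and plaquette operators on kets -/

/-- The gauge transformation by `g` along a list of edges. -/
def gauge (l : List (E × Bool)) (g : G) (x : E → G) : E → G := fun e =>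
  if (e, true) ∈ l then x e * g⁻¹ else if (e, false) ∈ l then g * x e else x e

theorem gauge_gauge (l : List (E × Bool)) (g h : G) (x : E → G) :
    gauge l g (gauge l h x) = gauge l (g * h) x := by
  funext e
  unfold gauge
  split_ifs <;> simp [mul_assoc]

theorem gauge_one (l : List (E × Bool)) (x : E → G) : gauge l 1 x = x := by
  funext e
  simp [gauge]

theorem prod_single_eq_gauge (l : List (E × Bool)) (hl : (l.map Prod.fst).Nodup) (g : G)
    (x : E → G) :
    (l.map fun j => if j.2 then Lminus j.1 g else Lplus j.1 g).prod (Finsupp.single x (1 : ℂ)) =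
      Finsupp.single (gauge l g x) 1 := by
  induction l with
  | nil =>
    have : gauge [] g x = x := by
      funext e
      simp [gauge]
    simp [this]
  | cons j l ih =>
    obtain ⟨e, b⟩ := j
    rw [List.map_cons, List.nodup_cons] at hl
    have he : ∀ b', (e, b') ∉ l := fun b' h => hl.1 (List.mem_map.2 ⟨_, h, rfl⟩)
    have key : gauge ((e, b) :: l) g x =
        Function.update (gauge l g x) e (if b then x e * g⁻¹ else g * x e) := by
      funext e'
      by_cases h : e' = e
      · subst h
        cases b <;> simp [gauge, he]
      · simp [gauge, h]
    have hx : gauge l g x e = x e := by simp [gauge, he]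
    rw [List.map_cons, List.prod_cons, Module.End.mul_apply, ih hl.2, key]
    cases b <;> simp [Lminus, Lplus, opOfKets_single, hx]

/-- The holonomy of a colouring along a list of edges. -/
def holonomy (l : List (E × Bool)) (x : E → G) : G :=
  (l.map fun j => if j.2 then (x j.1)⁻¹ else x j.1).prod

namespace Cilium

variable (s : Cilium E)

theorem star_nodup : (s.star.map Prod.fst).Nodup := by
  have h := s.nodup
  simp only [star, List.map_cons, List.map_append, List.cons_append, List.nodup_cons,
    List.nodup_append, List.mem_append, List.mem_cons, List.map_nil, List.not_mem_nil] at h ⊢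
  grind

/-- Only the first and the last boundary edge meet the vertex. With either orientation the first
contributes a factor `g` on the left and the last a factor `g⁻¹` on the right. -/
theorem holonomy_gauge (g : G) (x : E → G) :
    holonomy s.boundary (gauge s.star g x) = g * holonomy s.boundary x * g⁻¹ := by
  have h := s.nodup
  simp only [List.map_cons, List.map_append, List.cons_append, List.nodup_cons,
    List.nodup_append, List.mem_append, List.mem_cons, List.map_nil, List.not_mem_nil] at h
  have h1 : s.first.1 ≠ s.last.1 := by grind
  have h2 : ∀ b, (s.first.1, b) ∉ s.rest := fun b hb => by
    have := List.mem_map_of_mem (f := Prod.fst) hb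
    grind
  have h3 : ∀ b, (s.last.1, b) ∉ s.rest := fun b hb => by
    have := List.mem_map_of_mem (f := Prod.fst) hb
    grind
  have hmid : ∀ j ∈ s.mid, gauge s.star g x j.1 = x j.1 := by
    intro j hj
    have hj' := List.mem_map_of_mem (f := Prod.fst) hj
    have hr : ∀ b, (j.1, b) ∉ s.rest := fun b hb => by
      have := List.mem_map_of_mem (f := Prod.fst) hb
      grind
    have hf : j.1 ≠ s.first.1 := by grind
    have hl : j.1 ≠ s.last.1 := by grind
    simp [gauge, star, hr, Prod.ext_iff, hf, hl]
  have e1 : (s.mid.map fun j => if j.2 then (gauge s.star g x j.1)⁻¹ else gauge s.star g x j.1) =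
      s.mid.map fun j => if j.2 then (x j.1)⁻¹ else x j.1 :=
    List.map_congr_left fun j hj => by rw [hmid j hj]
  have e2 : gauge s.star g x s.first.1 =
      if s.first.2 then x s.first.1 * g⁻¹ else g * x s.first.1 := by
    cases hb : s.first.2 <;> simp [gauge, star, h1, h2, Prod.ext_iff, hb]
  have e3 : gauge s.star g x s.last.1 =
      if s.last.2 then g * x s.last.1 else x s.last.1 * g⁻¹ := by
    cases hb : s.last.2 <;> simp [gauge, star, Ne.symm h1, h3, Prod.ext_iff, hb]
  simp only [holonomy, boundary, List.map_append, List.map_cons, List.prod_append, List.prod_cons,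
    e1, e2, e3, List.map_nil, List.prod_nil]
  cases s.first.2 <;> cases s.last.2 <;> simp [mul_assoc]

theorem exists_holonomy_eq (g : G) : ∃ x : E → G, holonomy s.boundary x = g := by
  refine ⟨fun e => if e = s.first.1 then (if s.first.2 then g⁻¹ else g) else 1, ?_⟩
  have h : ∀ j ∈ s.mid ++ [s.last], j.1 ≠ s.first.1 := by
    intro j hj
    have := List.mem_map_of_mem (f := Prod.fst) hj
    have hn := s.nodup
    simp only [List.map_cons, List.map_append, List.cons_append, List.nodup_cons,
      List.nodup_append, List.mem_append, List.mem_cons, List.map_nil, List.not_mem_nil] at hn this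
    grind
  have e : ((s.mid ++ [s.last]).map fun j : E × Bool => if j.2 then
      (if j.1 = s.first.1 then (if s.first.2 then g⁻¹ else g) else 1)⁻¹ else
      (if j.1 = s.first.1 then (if s.first.2 then g⁻¹ else g) else 1)) =
      (s.mid ++ [s.last]).map fun _ => (1 : G) :=
    List.map_congr_left fun j hj => by simp [h j hj]
  rw [holonomy, boundary, List.cons_append, List.map_cons, List.prod_cons, e]
  cases s.first.2 <;> simp

/-- The gauge action is free because it is already free on the edge `first`. -/
theorem gauge_star_injective (x : E → G) : Function.Injective fun g => gauge s.star g x := by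
  intro g h hgh
  have := congrFun hgh s.first.1
  by_cases hb : (s.first.1, true) ∈ s.star
  · simpa [gauge, hb] using this
  · have hf : (s.first.1, false) ∈ s.star := by
      have : s.first ∈ s.star := by simp [star]
      rcases hs : s.first with ⟨e, b⟩
      cases b <;> simp_all
    simpa [gauge, hb, hf] using this

end Cilium

variable [Fintype G]

/-- Each `T` projects onto one edge value, so of all factorisations of `h` only the one by the
actual edge values of `x` can survive. -/
theorem holonomyOp_single (l : List (E × Bool)) (h : G) (x : E → G) :
    holonomyOp l h (Finsupp.single x 1) =
      if holonomy l x = h then Finsupp.single x 1 else 0 := by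
  induction l generalizing h with
  | nil =>
    by_cases hh : h = 1
    · simp [holonomyOp, holonomy, hh]
    · simp [holonomyOp, holonomy, hh, Ne.symm hh]
  | cons j l ih =>
    obtain ⟨e, b⟩ := j
    simp only [holonomyOp, LinearMap.sum_apply, Module.End.mul_apply, ih]
    have hT : ∀ g : G, (if b then Tminus e g else Tplus e g) (Finsupp.single x (1 : ℂ)) =
        if (if b then (x e)⁻¹ else x e) = g then Finsupp.single x 1 else 0 := by
      intro g
      cases b <;> simp [Tminus, Tplus, opOfKets_single, inv_eq_iff_eq_inv]
    rw [Finset.sum_eq_single (if b then (x e)⁻¹ else x e)]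
    · rw [apply_ite (DFunLike.coe _), hT]
      simp [holonomy, eq_inv_mul_iff_mul_eq]
    · intro g _ hg
      rw [apply_ite (DFunLike.coe _), hT]
      simp [Ne.symm hg]
    · simp

variable {K : Subgroup G}

/-- The vertex operator acts first, so the holonomy is tested on the transformed colouring. -/
theorem localOp_single (s : Cilium E) (c : G ⧸ K) (k : K) (x : E → G) :
    localOp s c k (Finsupp.single x 1) =
      if (QuotientGroup.mk (holonomy s.boundary (gauge s.star (k : G) x)) : G ⧸ K) = c then
        Finsupp.single (gauge s.star (k : G) x) 1 else 0 := by
  rw [localOp, Module.End.mul_apply, vertexOp, prod_single_eq_gauge _ s.star_nodup,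
    LinearMap.sum_apply]
  simp only [plaquetteOp, holonomyOp_single]
  rw [Finset.sum_ite_eq]
  simp

theorem localMap_single (s : Cilium E) (z : LocalAlgebra K) (x : E → G) :
    localMap K s z (Finsupp.single x 1) =
      ∑ k : K, z (QuotientGroup.mk (holonomy s.boundary (gauge s.star (k : G) x)), k) •
        Finsupp.single (gauge s.star (k : G) x) 1 := by
  change (∑ p : (G ⧸ K) × K, z p • localOp s p.1 p.2) _ = _
  simp only [LinearMap.sum_apply, LinearMap.smul_apply, localOp_single, Fintype.sum_prod_type_right]
  refine Finset.sum_congr rfl fun k _ => ?_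
  rw [Finset.sum_eq_single (QuotientGroup.mk (holonomy s.boundary (gauge s.star (k : G) x)))]
  · simp
  · intro c _ hc
    simp [Ne.symm hc]
  · simp

theorem localMap_mul (s : Cilium E) (z w : LocalAlgebra K) :
    localMap K s (z * w) = localMap K s z * localMap K s w := by
  refine op_ext fun x => ?_
  rw [Module.End.mul_apply, localMap_single, localMap_single, map_sum]
  simp only [map_smul, localMap_single, LocalAlgebra.mul_apply, Finset.sum_smul, Finset.smul_sum]
  rw [Finset.sum_comm]
  conv_rhs => rw [Finset.sum_comm]
  refine Finset.sum_congr rfl fun j _ => ?_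
  refine Fintype.sum_equiv (Equiv.mulLeft j⁻¹) _ _ fun k => ?_
  have hk : (j : G) * ((j⁻¹ * k : K) : G) = k := by simp
  -- Gauging by `j` conjugates the holonomy by `j`; the right factor `j⁻¹` lies in `K` and
  -- disappears in `G ⧸ K`. What is left is the translation in the product of `LocalAlgebra K`.
  have hmk : (QuotientGroup.mk (holonomy s.boundary (gauge s.star ((j⁻¹ * k : K) : G) x)) : G ⧸ K) =
      j⁻¹ • (QuotientGroup.mk (holonomy s.boundary (gauge s.star (k : G) x)) : G ⧸ K) := by
    rw [eq_inv_smul_iff, ← hk, ← gauge_gauge, s.holonomy_gauge (j : G)]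
    exact QuotientGroup.eq.2 (by simp [mul_assoc])
  rw [Equiv.coe_mulLeft, gauge_gauge, hk, hmk, smul_smul, mul_comm]

theorem localMap_one (s : Cilium E) : localMap K s 1 = 1 := by
  refine op_ext fun x => ?_
  rw [localMap_single, Finset.sum_eq_single 1]
  · simp [LocalAlgebra.one_apply, gauge_one]
  · intro k _ hk
    simp [LocalAlgebra.one_apply, hk]
  · simp

theorem localMap_injective (s : Cilium E) : Function.Injective (localMap K s) := by
  rw [injective_iff_map_eq_zero]
  intro z hz
  ext ⟨c, k⟩
  obtain ⟨g, rfl⟩ := QuotientGroup.mk_surjective c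
  -- After gauging by `k` this holonomy becomes `g k⁻¹`, which lies in `gK`. By freeness the
  -- coefficient of the ket `gauge s.star k x` is then exactly `z (gK, k)`.
  obtain ⟨x, hx⟩ := s.exists_holonomy_eq ((k : G)⁻¹ * g)
  have h := localMap_single s z x
  rw [hz] at h
  have h' := DFunLike.congr_fun h (gauge s.star (k : G) x)
  rw [Finsupp.finsetSum_apply, Finset.sum_eq_single k] at h'
  · rw [s.holonomy_gauge, hx] at h'
    have hmk : (QuotientGroup.mk ((k : G) * ((k : G)⁻¹ * g) * (k : G)⁻¹) : G ⧸ K) =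
        QuotientGroup.mk g := QuotientGroup.eq.2 (by simp [mul_assoc])
    rw [hmk] at h'
    simpa [LocalAlgebra.zero_apply, eq_comm] using h'
  · intro j _ hj
    have : gauge s.star (j : G) x ≠ gauge s.star (k : G) x := fun h =>
      hj (Subtype.ext (s.gauge_star_injective x h))
    simp [this]
  · simp

end Lattice
-- Matrix elements of ribbon operators and their faithfulness
section Ribbon

variable {E G : Type*} [Group G] {K : Subgroup G}

/-- The ribbon operator `Y_ρ^{(c,k)}` has a nonzero matrix element between the kets `|x⟩` and `|y⟩`,
as far as the edges of the ribbon are concerned. -/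
def RibbonTransition (x y : E → G) : List (Triangle E) → G ⧸ K → K → Prop
  | [], _, k => k = 1
  | .dual e pos :: ρ, c, k =>
      QuotientGroup.mk (if pos then y e * (x e)⁻¹ else (y e)⁻¹ * x e) = c ∧
        RibbonTransition x y ρ c k
  | .direct e pos :: ρ, c, k =>
      y e = x e ∧ ∃ j : K, (if pos then x e else (x e)⁻¹) = j ∧
        RibbonTransition x y ρ (j⁻¹ • c) (j⁻¹ * k)

theorem ribbonTransition_congr {x y x' y' : E → G} (ρ : List (Triangle E)) (c : G ⧸ K) (k : K)
    (hx : ∀ τ ∈ ρ, x τ.edge = x' τ.edge) (hy : ∀ τ ∈ ρ, y τ.edge = y' τ.edge) :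
    RibbonTransition x y ρ c k ↔ RibbonTransition x' y' ρ c k := by
  induction ρ generalizing c k with
  | nil => rfl
  | cons τ ρ ih =>
    have h1 := hx τ (by simp)
    have h2 := hy τ (by simp)
    have ih' := fun c k => ih c k (fun τ hτ => hx τ (by simp [hτ])) (fun τ hτ => hy τ (by simp [hτ]))
    cases τ <;> simp only [RibbonTransition, Triangle.edge] at h1 h2 ⊢ <;> simp only [h1, h2, ih']

/-- The value `k` is the product of the values on the direct edges, so without a direct triangle
only `k = 1` occurs. On a dual edge `y` is chosen to differ from `x` by a representative of the
required coset. -/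
theorem exists_ribbonTransition (ρ : List (Triangle E)) (hρ : (ρ.map Triangle.edge).Nodup)
    (c : G ⧸ K) (k : K) (hk : k = 1 ∨ ∃ e pos, Triangle.direct e pos ∈ ρ) :
    ∃ x y : E → G, (∀ e, e ∉ ρ.map Triangle.edge → y e = x e) ∧ RibbonTransition x y ρ c k := by
  induction ρ generalizing c k with
  | nil => exact ⟨1, 1, fun _ _ => rfl, hk.resolve_right (by simp)⟩
  | cons τ ρ ih =>
    rw [List.map_cons, List.nodup_cons] at hρ
    have hne : ∀ τ' ∈ ρ, τ'.edge ≠ τ.edge := fun τ' hτ' h =>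
      hρ.1 (h ▸ List.mem_map_of_mem hτ')
    cases τ with
    | dual e pos =>
      obtain ⟨x, y, hxy, h⟩ := ih hρ.2 c k (by simpa using hk)
      obtain ⟨g, rfl⟩ := QuotientGroup.mk_surjective c
      refine ⟨x, Function.update y e (if pos then g * x e else x e * g⁻¹), fun e' he' => ?_, ?_, ?_⟩
      · simp only [List.map_cons, List.mem_cons, not_or, Triangle.edge] at he'
        rw [Function.update_of_ne he'.1, hxy e' he'.2]
      · cases pos <;> simp
      · refine (ribbonTransition_congr ρ _ k (fun _ _ => rfl) fun τ' hτ' => ?_).1 h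
        exact (Function.update_of_ne (hne τ' hτ') _ _).symm
    | direct e pos =>
      -- The first direct triangle absorbs all of `k`, so the rest of the ribbon has to produce only
      -- `1` and needs no direct triangle.
      obtain ⟨x, y, hxy, h⟩ := ih hρ.2 (k⁻¹ • c) 1 (Or.inl rfl)
      refine ⟨Function.update x e (if pos then (k : G) else (k : G)⁻¹),
        Function.update y e (if pos then (k : G) else (k : G)⁻¹), fun e' he' => ?_, ?_, k, ?_, ?_⟩
      · simp only [List.map_cons, List.mem_cons, not_or, Triangle.edge] at he'
        rw [Function.update_of_ne he'.1, Function.update_of_ne he'.1, hxy e' he'.2]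
      · simp
      · cases pos <;> simp
      · rw [inv_mul_cancel]
        refine (ribbonTransition_congr ρ _ 1 (fun τ' hτ' => ?_) fun τ' hτ' => ?_).1 h
        · exact (Function.update_of_ne (hne τ' hτ') _ _).symm
        · exact (Function.update_of_ne (hne τ' hτ') _ _).symm

/-- The kets fix the element of `K` read on every direct edge, hence `k`. The coset `c` is
constrained only at dual triangles, so at least one of these is needed to recover it. -/
theorem ribbonTransition_unique {x y : E → G} (ρ : List (Triangle E)) {c c' : G ⧸ K} {k k' : K}
    (h : RibbonTransition x y ρ c k) (h' : RibbonTransition x y ρ c' k') :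
    k = k' ∧ ((∃ e pos, Triangle.dual e pos ∈ ρ) → c = c') := by
  induction ρ generalizing c c' k k' with
  | nil => exact ⟨h.trans h'.symm, by simp⟩
  | cons τ ρ ih =>
    cases τ with
    | dual e pos => exact ⟨(ih h.2 h'.2).1, fun _ => h.1.symm.trans h'.1⟩
    | direct e pos =>
      obtain ⟨-, j, hj, h⟩ := h
      obtain ⟨-, j', hj', h'⟩ := h'
      obtain rfl : j = j' := Subtype.ext (hj.symm.trans hj')
      obtain ⟨h1, h2⟩ := ih h h'
      exact ⟨by simpa using h1, fun hd => by simpa using h2 (by simpa using hd)⟩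

theorem Lplus_apply (e : E) (g : G) (v : LatticeState E G) (y : E → G) :
    Lplus e g v y = v (Function.update y e (g⁻¹ * y e)) := by
  have key : ∀ x : E → G, Function.update x e (g * x e) = y ↔
      x = Function.update y e (g⁻¹ * y e) := fun x =>
    ⟨by rintro rfl; simp, by rintro rfl; simp⟩
  induction v using Finsupp.induction_linear with
  | zero => simp
  | add v w hv hw => simp [hv, hw]
  | single x a =>
    simp only [Lplus, opOfKets, Finsupp.linearCombination_single, Finsupp.smul_apply,
      Finsupp.single_apply, key, smul_eq_mul, mul_ite, mul_one, mul_zero]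

theorem Lminus_apply (e : E) (g : G) (v : LatticeState E G) (y : E → G) :
    Lminus e g v y = v (Function.update y e (y e * g)) := by
  have key : ∀ x : E → G, Function.update x e (x e * g⁻¹) = y ↔
      x = Function.update y e (y e * g) := fun x =>
    ⟨by rintro rfl; simp, by rintro rfl; simp⟩
  induction v using Finsupp.induction_linear with
  | zero => simp
  | add v w hv hw => simp [hv, hw]
  | single x a =>
    simp only [Lminus, opOfKets, Finsupp.linearCombination_single, Finsupp.smul_apply,
      Finsupp.single_apply, key, smul_eq_mul, mul_ite, mul_one, mul_zero]

theorem Tplus_apply {E G : Type*} (e : E) (g : G) (v : LatticeState E G) (y : E → G) :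
    Tplus e g v y = if y e = g then v y else 0 := by
  induction v using Finsupp.induction_linear with
  | zero => simp
  | add v w hv hw => simp only [map_add, Finsupp.add_apply, hv, hw]; split_ifs <;> simp
  | single x a =>
    by_cases hxy : x = y
    · subst hxy
      by_cases h : x e = g <;> simp [Tplus, opOfKets, h]
    · by_cases h : x e = g <;> simp [Tplus, opOfKets, h, hxy]

theorem Tminus_apply (e : E) (g : G) (v : LatticeState E G) (y : E → G) :
    Tminus e g v y = if y e = g⁻¹ then v y else 0 :=
  Tplus_apply e g⁻¹ v y

variable [Fintype G]

/-- The matrix elements of a ribbon operator. -/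
theorem ribbonOp_single_apply_ne_zero (ρ : List (Triangle E))
    (hρ : (ρ.map Triangle.edge).Nodup) (c : G ⧸ K) (k : K) (x y : E → G) :
    ribbonOp ρ c k (Finsupp.single x 1) y ≠ 0 ↔
      (∀ e, e ∉ ρ.map Triangle.edge → y e = x e) ∧ RibbonTransition x y ρ c k := by
  induction ρ generalizing c k y with
  | nil =>
    by_cases hk : k = 1
    · simp [ribbonOp, RibbonTransition, hk, Finsupp.single_apply, funext_iff, eq_comm]
    · simp [ribbonOp, RibbonTransition, hk]
  | cons τ ρ ih =>
    rw [List.map_cons, List.nodup_cons] at hρ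
    have hne : ∀ τ' ∈ ρ, τ'.edge ≠ τ.edge := fun τ' hτ' h =>
      hρ.1 (h ▸ List.mem_map_of_mem hτ')
    specialize ih hρ.2
    cases τ with
    | dual e pos =>
      have ih' : ∀ a, ribbonOp ρ c k (Finsupp.single x 1) (Function.update y e a) ≠ 0 ↔
          a = x e ∧ (∀ e', e' ∉ (Triangle.dual e pos :: ρ).map Triangle.edge → y e' = x e') ∧
            RibbonTransition x y ρ c k := by
        intro a
        rw [ih, ← and_assoc]
        refine and_congr ⟨fun h => ⟨?_, fun e' he' => ?_⟩, fun h e' he' => ?_⟩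
          (ribbonTransition_congr ρ c k (fun _ _ => rfl)
            fun τ' hτ' => Function.update_of_ne (hne τ' hτ') _ _)
        · simpa using h e hρ.1
        · simp only [List.map_cons, List.mem_cons, not_or, Triangle.edge] at he'
          simpa [Function.update_of_ne he'.1] using h e' he'.2
        · by_cases hee : e' = e
          · subst hee
            simpa using h.1
          · rw [Function.update_of_ne hee]
            exact h.2 e' (by simp [Triangle.edge, hee, he'])
      have hsum : ribbonOp (Triangle.dual e pos :: ρ) c k (Finsupp.single x 1) y =
          (Nat.card K : ℂ)⁻¹ * ∑ j : G with (QuotientGroup.mk j : G ⧸ K) = c,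
            ribbonOp ρ c k (Finsupp.single x 1)
              (Function.update y e (if pos then j⁻¹ * y e else y e * j)) := by
        rw [ribbonOp, Finset.sum_eq_single 1]
        · cases pos <;> simp [triangleOp, Lplus_apply, Lminus_apply, LinearMap.sum_apply]
        · intro j _ hj
          simp [triangleOp, hj]
        · simp
      -- The rest of the ribbon does not touch `e`, so only the `j` that carries `x e` to `y e`
      -- contributes. The sum over the coset therefore has at most one nonzero term and nothing can
      -- cancel.
      have hzero : ∀ j : G, j ≠ (if pos then y e * (x e)⁻¹ else (y e)⁻¹ * x e) →
          ribbonOp ρ c k (Finsupp.single x 1)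
              (Function.update y e (if pos then j⁻¹ * y e else y e * j)) = 0 := by
        intro j hj
        by_contra h
        refine hj ?_
        have := ((ih' _).1 h).1
        cases pos
        · simp only [Bool.false_eq_true, if_false] at this ⊢
          rw [← this]; group
        · simp only [if_true] at this ⊢
          rw [← this]; group
      have hcard : (Nat.card K : ℂ)⁻¹ ≠ 0 := inv_ne_zero (Nat.cast_ne_zero.2 Nat.card_pos.ne')
      rw [hsum, mul_ne_zero_iff, RibbonTransition]
      simp only [hcard, ne_eq, not_false_eq_true, true_and]
      by_cases hc : (QuotientGroup.mk (if pos then y e * (x e)⁻¹ else (y e)⁻¹ * x e) : G ⧸ K) = c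
      · rw [Finset.sum_eq_single (if pos then y e * (x e)⁻¹ else (y e)⁻¹ * x e)
          (fun j _ hj => hzero j hj) (fun h => absurd hc (by simpa using h)), ← ne_eq, ih']
        have : (if pos then (if pos then y e * (x e)⁻¹ else (y e)⁻¹ * x e)⁻¹ * y e else
          y e * (if pos then y e * (x e)⁻¹ else (y e)⁻¹ * x e)) = x e := by cases pos <;> simp
        simp only [this, hc, true_and]
      · rw [Finset.sum_eq_zero]
        · simp [hc]
        · intro j hj
          refine hzero j fun h => hc ?_
          rw [← h]
          simpa using hj
    | direct e pos =>
      have hsum : ribbonOp (Triangle.direct e pos :: ρ) c k (Finsupp.single x 1) y =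
          ∑ j : K, if (if pos then y e else (y e)⁻¹) = (j : G) then
            ribbonOp ρ (j⁻¹ • c) (j⁻¹ * k) (Finsupp.single x 1) y else 0 := by
        rw [ribbonOp, LinearMap.sum_apply, Finsupp.finsetSum_apply]
        refine Finset.sum_congr rfl fun j _ => ?_
        cases pos <;> simp [triangleOp, Tplus_apply, Tminus_apply, inv_eq_iff_eq_inv]
      -- A direct triangle leaves its edge unchanged, and `e` is off the remaining ribbon: the
      -- off-ribbon condition for `ρ` already contains `y e = x e`.
      have hoff : (∀ e', e' ∉ ρ.map Triangle.edge → y e' = x e') ↔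
          (∀ e', e' ∉ (Triangle.direct e pos :: ρ).map Triangle.edge → y e' = x e') ∧
            y e = x e := by
        refine ⟨fun h => ⟨fun e' he' => h e' fun h' => he' (by simp [h']), h e hρ.1⟩,
          fun h e' he' => ?_⟩
        by_cases hee : e' = e
        · rw [hee, h.2]
        · exact h.1 e' (by simp [Triangle.edge, hee, he'])
      rw [hsum, RibbonTransition]
      by_cases hj : ∃ j : K, (if pos then y e else (y e)⁻¹) = (j : G)
      · obtain ⟨j, hj⟩ := hj
        rw [Finset.sum_eq_single j
          (fun i _ hi => if_neg fun h => hi (Subtype.ext (h.symm.trans hj))) (by simp),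
          if_pos hj, ih, hoff, and_assoc]
        refine and_congr_right fun _ => and_congr_right fun hyx => ?_
        rw [hyx] at hj
        refine ⟨fun h => ⟨j, hj, h⟩, ?_⟩
        rintro ⟨i, hi, h⟩
        obtain rfl : i = j := Subtype.ext (hi.symm.trans hj)
        exact h
      · rw [Finset.sum_eq_zero fun j _ => if_neg fun h => hj ⟨j, h⟩]
        simp only [ne_eq, not_true_eq_false, false_iff]
        rintro ⟨-, hyx, j, h, -⟩
        exact hj ⟨j, by rwa [hyx]⟩

theorem LocalAlgebra.eq_sum_zElt (z : LocalAlgebra K) :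
    z = ∑ p : (G ⧸ K) × K, z p • zElt p.1 p.2 :=
  pi_eq_sum_univ' z |>.trans <| Finset.sum_congr rfl fun p _ => by
    congr 1
    funext q
    simp [zElt, Pi.single_apply]

theorem RibbonAlgebra.ext_zElt {y y' : RibbonAlgebra K}
    (h : ∀ c k, y (zElt c k) = y' (zElt c k)) : y = y' := by
  refine LinearMap.ext fun z => ?_
  rw [z.eq_sum_zElt]
  simp only [map_sum, map_smul, h]

/-- For each label there is a pair of kets whose matrix element vanishes for all other labels; it
isolates one coefficient of `y`. -/
theorem ribbonMap_injective {ρ : List (Triangle E)} (hρ : IsBoundaryRibbon ρ) :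
    Function.Injective (ribbonMap K ρ) := by
  rw [injective_iff_map_eq_zero]
  intro y hy
  refine RibbonAlgebra.ext_zElt fun c k => ?_
  obtain ⟨u, v, huv, h⟩ := exists_ribbonTransition ρ hρ.nodup c k (Or.inr hρ.exists_direct)
  have h0 : ribbonMap K ρ y (Finsupp.single u 1) v = 0 := by simp [hy]
  change (∑ p : (G ⧸ K) × K, y (zElt p.1 p.2) • ribbonOp ρ p.1 p.2) _ v = 0 at h0
  rw [LinearMap.sum_apply, Finsupp.finsetSum_apply, Finset.sum_eq_single (c, k)] at h0
  · have hne := (ribbonOp_single_apply_ne_zero ρ hρ.nodup c k u v).2 ⟨huv, h⟩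
    simpa [hne] using h0
  · rintro ⟨c', k'⟩ _ hp
    have : ribbonOp ρ c' k' (Finsupp.single u 1) v = 0 := by
      by_contra hne
      have h' := ((ribbonOp_single_apply_ne_zero ρ hρ.nodup c' k' u v).1 hne).2
      obtain ⟨h1, h2⟩ := ribbonTransition_unique ρ h' h
      exact hp (Prod.ext (h2 hρ.exists_dual) h1)
    simp [this]
  · simp

end Ribbon
section Schur

/-! ### Matrix elements of irreducible representations of a finite group -/

variable {H : Type*} [Group H]

namespace MatrixIrrep

theorem matrix_mul (Γ : MatrixIrrep H) (a b : H) :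
    Γ.matrix (a * b) = Γ.matrix a * Γ.matrix b := by
  simp [matrix, LinearMap.toMatrix'_mul]

theorem matrix_one (Γ : MatrixIrrep H) : Γ.matrix 1 = 1 := by
  simp [matrix]

theorem matrix_inv (Γ : MatrixIrrep H) (a : H) : (Γ.matrix a)⁻¹ = Γ.matrix a⁻¹ :=
  Matrix.inv_eq_left_inv (by rw [← matrix_mul, inv_mul_cancel, matrix_one])

theorem dim_pos (Γ : MatrixIrrep H) : 0 < Γ.dim := by
  have := Γ.irreducible
  rw [Representation.irreducible_iff_isSimpleModule_asModule] at this
  have h : Nontrivial (Fin Γ.dim → ℂ) :=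
    IsSimpleModule.nontrivial (MonoidAlgebra ℂ H) Γ.rep.asModule
  by_contra h0
  obtain ⟨a, b, hab⟩ := h
  refine hab (funext fun i => ?_)
  have := i.pos
  omega

/-- The linear map with matrix `A` intertwines when `A` commutes with the matrix forms. -/
def intertwiner (Γ' Γ : MatrixIrrep H) (A : Matrix (Fin Γ.dim) (Fin Γ'.dim) ℂ)
    (hA : ∀ k, A * Γ'.matrix k = Γ.matrix k * A) : Representation.IntertwiningMap Γ'.rep Γ.rep where
  toLinearMap := Matrix.toLin' A
  isIntertwining' k := by
    have := congrArg Matrix.toLin' (hA k)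
    simpa [matrix, Matrix.toLin'_mul] using this

theorem eq_zero_of_intertwines {Γ' Γ : MatrixIrrep H} (h : ¬ Γ' ≈ Γ)
    (A : Matrix (Fin Γ.dim) (Fin Γ'.dim) ℂ) (hA : ∀ k, A * Γ'.matrix k = Γ.matrix k * A) :
    A = 0 := by
  have := Γ.irreducible
  have := Γ'.irreducible
  rcases Representation.IsIrreducible.bijective_or_eq_zero (intertwiner Γ' Γ A hA) with hb | h0
  · exact absurd ⟨(intertwiner Γ' Γ A hA).ofBijective hb⟩ h
  · have : Matrix.toLin' A = 0 := congrArg Representation.IntertwiningMap.toLinearMap h0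
    simpa using this

theorem exists_eq_smul_one_of_intertwines {Γ : MatrixIrrep H}
    (A : Matrix (Fin Γ.dim) (Fin Γ.dim) ℂ) (hA : ∀ k, A * Γ.matrix k = Γ.matrix k * A) :
    ∃ c : ℂ, A = c • 1 := by
  have := Γ.irreducible
  obtain ⟨c, hc⟩ := (Representation.IsIrreducible.algebraMap_intertwiningMap_bijective_of_isAlgClosed
    (k := ℂ) (ρ := Γ.rep)).2 (intertwiner Γ Γ A hA)
  refine ⟨c, Matrix.toLin'.injective ?_⟩
  have h1 : Matrix.toLin' A =
      (algebraMap ℂ (Representation.IntertwiningMap Γ.rep Γ.rep) c).toLinearMap :=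
    (congrArg Representation.IntertwiningMap.toLinearMap hc).symm
  rw [h1, map_smul, Matrix.toLin'_one]
  rfl

variable [Fintype H]

/-- Averaging an arbitrary matrix over the group makes it an intertwiner, to which Schur's lemma
applies. -/
theorem sum_conj_intertwines (Γ' Γ : MatrixIrrep H) (A : Matrix (Fin Γ.dim) (Fin Γ'.dim) ℂ)
    (k : H) :
    (∑ m, Γ.matrix m * A * Γ'.matrix m⁻¹) * Γ'.matrix k =
      Γ.matrix k * ∑ m, Γ.matrix m * A * Γ'.matrix m⁻¹ := by
  rw [Matrix.sum_mul, Matrix.mul_sum]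
  refine Fintype.sum_equiv (Equiv.mulLeft k⁻¹) _ _ fun m => ?_
  rw [Equiv.coe_mulLeft, Matrix.mul_assoc, ← matrix_mul, ← Matrix.mul_assoc, ← Matrix.mul_assoc,
    ← matrix_mul]
  simp

/-- For an elementary matrix the entries of the average are the sums in the orthogonality relations.
-/
theorem sum_conj_apply (Γ' Γ : MatrixIrrep H) (p q : Fin Γ.dim) (j l : Fin Γ'.dim) :
    (∑ m, Γ.matrix m * Matrix.single q j (1 : ℂ) * Γ'.matrix m⁻¹) p l =
      ∑ m, Γ.matrix m p q * Γ'.matrix m⁻¹ j l := by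
  rw [Matrix.sum_apply]
  refine Finset.sum_congr rfl fun m _ => ?_
  rw [Matrix.mul_apply, Finset.sum_eq_single j]
  · simp
  · intro b _ hb
    simp [hb]
  · simp

/-- Schur orthogonality for inequivalent representations. -/
theorem sum_mul_eq_zero {Γ' Γ : MatrixIrrep H} (h : ¬ Γ' ≈ Γ) (p q : Fin Γ.dim)
    (j l : Fin Γ'.dim) : ∑ m, Γ.matrix m p q * Γ'.matrix m⁻¹ j l = 0 := by
  rw [← sum_conj_apply, eq_zero_of_intertwines h _ (sum_conj_intertwines Γ' Γ _)]
  rfl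

/-- Schur orthogonality for the matrix elements of one representation. -/
theorem sum_mul_eq (Γ : MatrixIrrep H) (p q j l : Fin Γ.dim) :
    ∑ m, Γ.matrix m p q * Γ.matrix m⁻¹ j l =
      if p = l ∧ q = j then (Fintype.card H : ℂ) / Γ.dim else 0 := by
  obtain ⟨c, hc⟩ := exists_eq_smul_one_of_intertwines _
    (sum_conj_intertwines Γ Γ (Matrix.single q j 1))
  have hd : (Γ.dim : ℂ) ≠ 0 := Nat.cast_ne_zero.2 Γ.dim_pos.ne'
  -- The trace determines the scalar: each conjugate of the elementary matrix has trace `δ_{qj}`.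
  have htr := congrArg Matrix.trace hc
  have hm : ∀ m, (Γ.matrix m * Matrix.single q j (1 : ℂ) * Γ.matrix m⁻¹).trace =
      if q = j then 1 else 0 := by
    intro m
    rw [Matrix.trace_mul_comm, ← Matrix.mul_assoc, ← matrix_mul, inv_mul_cancel, matrix_one,
      Matrix.one_mul]
    by_cases hqj : q = j
    · subst hqj
      simp
    · simp [hqj]
  rw [Matrix.trace_sum, Finset.sum_congr rfl fun m _ => hm m, Matrix.trace_smul,
    Matrix.trace_one] at htr
  rw [← sum_conj_apply, hc, Matrix.smul_apply, Matrix.one_apply]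
  have hc' : c = (if q = j then (Fintype.card H : ℂ) else 0) / Γ.dim := by
    rw [eq_div_iff hd]
    split_ifs at htr ⊢ <;> simpa using htr.symm
  rw [hc']
  by_cases h1 : p = l <;> by_cases h2 : q = j <;> simp [h1, h2]

end MatrixIrrep

/-- Every simple module over the group algebra of a finite group has a matrix form. -/
theorem exists_matrixIrrep [Finite H] (M : Type*) [AddCommGroup M] [Module ℂ M]
    [Module (MonoidAlgebra ℂ H) M] [IsScalarTower ℂ (MonoidAlgebra ℂ H) M] [FiniteDimensional ℂ M]
    [IsSimpleModule (MonoidAlgebra ℂ H) M] :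
    ∃ Γ : MatrixIrrep H, Nonempty (Γ.rep.asModule ≃ₗ[MonoidAlgebra ℂ H] M) := by
  let e : M ≃ₗ[ℂ] (Fin (Module.finrank ℂ M) → ℂ) := (Module.finBasis ℂ M).equivFun
  let ρ : Representation ℂ H (Fin (Module.finrank ℂ M) → ℂ) :=
    (e.conjAlgEquiv ℂ : Module.End ℂ M →* _).comp (Representation.ofModule' M)
  have hρ : ∀ k v, ρ k v = e (MonoidAlgebra.single k (1 : ℂ) • e.symm v) := fun k v => rfl
  let f : ρ.asModule ≃ₗ[MonoidAlgebra ℂ H] M :=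
    { (ρ.asModuleEquiv.trans e.symm).toAddEquiv with
      map_smul' := fun r x => by
        change e.symm (ρ.asAlgebraHom r (ρ.asModuleEquiv x)) = r • e.symm (ρ.asModuleEquiv x)
        generalize ρ.asModuleEquiv x = v
        induction r using MonoidAlgebra.induction_linear with
        | zero => simp
        | add a b ha hb => simp [add_smul, ha, hb]
        | single k a =>
          rw [Representation.asAlgebraHom_single, LinearMap.smul_apply, hρ, map_smul,
            LinearEquiv.symm_apply_apply, ← smul_assoc]
          simp }
  have : IsSimpleModule (MonoidAlgebra ℂ H) ρ.asModule := IsSimpleModule.congr f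
  exact ⟨⟨_, ρ, ρ.irreducible_iff_isSimpleModule_asModule.2 this⟩, ⟨f⟩⟩

/-- A function on a finite group whose Fourier transform vanishes is zero. -/
theorem eq_zero_of_sum_smul_rep_eq_zero [Fintype H] (f : H → ℂ)
    (hf : ∀ Γ : MatrixIrrep H, ∑ k, f k • Γ.rep k = 0) : f = 0 := by
  let a : MonoidAlgebra ℂ H := ∑ k, MonoidAlgebra.single k (f k)
  -- The element with coefficients `f` acts as zero on every simple module, hence lies in every
  -- maximal left ideal. The radical vanishes by Maschke's theorem.
  have ha : a ∈ Ring.jacobson (MonoidAlgebra ℂ H) := by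
    rw [Ring.jacobson_eq_sInf_isMaximal, Submodule.mem_sInf]
    intro I hI
    have : IsSimpleModule (MonoidAlgebra ℂ H) (MonoidAlgebra ℂ H ⧸ I) :=
      isSimpleModule_iff_isCoatom.2 (Ideal.isMaximal_def.1 hI)
    obtain ⟨Γ, ⟨φ⟩⟩ := exists_matrixIrrep (H := H) (MonoidAlgebra ℂ H ⧸ I)
    have h0 : a • φ.symm (Submodule.Quotient.mk 1) = 0 := by
      apply Γ.rep.asModuleEquiv.injective
      rw [Representation.asModuleEquiv_map_smul, map_sum]
      simp only [Representation.asAlgebraHom_single, hf Γ]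
      simp
    have h1 : a • (Submodule.Quotient.mk 1 : MonoidAlgebra ℂ H ⧸ I) = 0 := by
      rw [← φ.apply_symm_apply (Submodule.Quotient.mk 1), ← map_smul, h0, map_zero]
    rw [← Submodule.Quotient.mk_smul, Submodule.Quotient.mk_eq_zero] at h1
    simpa using h1
  have : NeZero (Nat.card H : ℂ) := ⟨Nat.cast_ne_zero.2 Nat.card_pos.ne'⟩
  rw [IsSemisimpleRing.jacobson_eq_bot, Submodule.mem_bot] at ha
  funext k
  have := DFunLike.congr_fun (congrArg MonoidAlgebra.coeff ha) k
  simpa [a, MonoidAlgebra.coeff_sum, Finsupp.finsetSum_apply, Finsupp.single_apply] using this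

end Schur
-- The action groupoid of `K` on `G ⧸ K`: orbits, isotropy groups and coordinates on arrows
section Coordinates

variable {G : Type*} [Group G] {K : Subgroup G}

/-- This identifies `K^r` as the isotropy group of the point `rK`. -/
theorem smul_mk_eq_mk_iff (r : G) (a : K) :
    a • (QuotientGroup.mk r : G ⧸ K) = QuotientGroup.mk r ↔ a ∈ stab K r := by
  rw [eq_comm, show a • (QuotientGroup.mk r : G ⧸ K) = QuotientGroup.mk ((a : G) * r) from rfl,
    QuotientGroup.eq, stab, Subgroup.mem_subgroupOf, Subgroup.mem_inf, Subgroup.mem_map]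
  constructor
  · intro h
    exact ⟨a.2, _, h, by simp [mul_assoc]⟩
  · rintro ⟨-, h, hh, hr⟩
    rw [← hr]
    simpa [mul_assoc] using hh

namespace FourierChoice

variable (C : FourierChoice K)

/-- The coset `s_i K` in the double coset `T`. -/
def base (T : DoubleCoset.Quotient (K : Set G) (K : Set G)) (i : K ⧸ stab K (C.r T)) : G ⧸ K :=
  QuotientGroup.mk ((C.q T i : G) * C.r T * (C.q T i : G)⁻¹)

variable {C} {T : DoubleCoset.Quotient (K : Set G) (K : Set G)}

theorem base_eq_smul (i : K ⧸ stab K (C.r T)) :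
    C.base T i = C.q T i • (QuotientGroup.mk (C.r T) : G ⧸ K) :=
  QuotientGroup.eq.2 (by simp [mul_assoc])

theorem base_eq_smul_base_iff (i l : K ⧸ stab K (C.r T)) (a : K) :
    C.base T i = a • C.base T l ↔ (C.q T i)⁻¹ * (a * C.q T l) ∈ stab K (C.r T) := by
  rw [← smul_mk_eq_mk_iff, base_eq_smul, base_eq_smul, mul_smul, mul_smul, inv_smul_eq_iff, eq_comm]

/-- The `K`-orbits in `G ⧸ K` are the double cosets, so no arrow joins points over different `T`. -/
theorem base_ne_smul_base {T' : DoubleCoset.Quotient (K : Set G) (K : Set G)} (h : T ≠ T')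
    (i : K ⧸ stab K (C.r T)) (l : K ⧸ stab K (C.r T')) (a : K) :
    C.base T i ≠ a • C.base T' l := by
  intro hb
  rw [base_eq_smul, base_eq_smul, smul_smul, ← eq_inv_smul_iff, smul_smul] at hb
  set b := (C.q T i)⁻¹ * (a * C.q T' l)
  have hb' := QuotientGroup.eq.1 (show (QuotientGroup.mk (C.r T) : G ⧸ K) =
    QuotientGroup.mk ((b : G) * C.r T') from hb)
  refine h ?_
  rw [← C.mk_r T, ← C.mk_r T', eq_comm, DoubleCoset.eq]
  exact ⟨b, b.2, _, K.inv_mem hb', by simp [mul_assoc]⟩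

theorem exists_eq_base (c : G ⧸ K) (k : K) : ∃ T i i', ∃ m : stab K (C.r T),
    c = C.base T i ∧ k = C.q T i * (m : K) * (C.q T i')⁻¹ := by
  obtain ⟨g, rfl⟩ := QuotientGroup.mk_surjective c
  obtain ⟨h, hh, k', hk', hg⟩ := (DoubleCoset.eq K K _ _).1 (C.mk_r (DoubleCoset.mk K K g))
  set T := DoubleCoset.mk K K g
  have hq : ∀ a : K, (C.q T (QuotientGroup.mk a))⁻¹ * a ∈ stab K (C.r T) := fun a =>
    QuotientGroup.eq.1 (C.mk_q T (QuotientGroup.mk a))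
  let i : K ⧸ stab K (C.r T) := QuotientGroup.mk ⟨h, hh⟩
  -- The index `i` names the target `c` of the arrow and `i'` its source `k⁻¹ • c`; the middle
  -- factor is then a loop at `r_T K`.
  let i' : K ⧸ stab K (C.r T) := QuotientGroup.mk (k⁻¹ * C.q T i)
  refine ⟨T, i, i', ⟨(C.q T i)⁻¹ * k * C.q T i', ?_⟩, ?_, ?_⟩
  · have := inv_mem (hq (k⁻¹ * C.q T i))
    simpa [mul_assoc] using this
  · rw [base_eq_smul, ← inv_smul_eq_iff]
    have h1 : (QuotientGroup.mk g : G ⧸ K) = (⟨h, hh⟩ : K) • QuotientGroup.mk (C.r T) :=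
      QuotientGroup.eq.2 (by
        have : g⁻¹ * (h * C.r T) = k'⁻¹ := by rw [hg]; group
        exact this ▸ K.inv_mem hk')
    rw [h1, smul_smul]
    exact (smul_mk_eq_mk_iff _ _).2 (hq _)
  · simp [mul_assoc]

variable (C) in
/-- The element `Z^{(s_i K, q_i k q_{i'}⁻¹)}`. -/
def zArrow (T : DoubleCoset.Quotient (K : Set G) (K : Set G)) (i : K ⧸ stab K (C.r T))
    (k : stab K (C.r T)) (i' : K ⧸ stab K (C.r T)) : LocalAlgebra K :=
  zElt (C.base T i) (C.q T i * (k : K) * (C.q T i')⁻¹)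

theorem q_inv_mul_q_mem_iff (i l : K ⧸ stab K (C.r T)) :
    (C.q T i)⁻¹ * C.q T l ∈ stab K (C.r T) ↔ i = l := by
  rw [← QuotientGroup.eq, C.mk_q, C.mk_q]

theorem base_injective : Function.Injective (C.base T) := fun i l h => by
  have := (base_eq_smul_base_iff i l 1).1 (by simpa using h)
  rwa [one_mul, q_inv_mul_q_mem_iff] at this

/-- The matrix element `Γ_R(k)_{pq}`. -/
def entry (x : C.Label) (k : stabT x) (p q : Fin (dimR x)) : ℂ := (C.Γ x.1 x.2).matrix k p q

theorem entry_mul (x : C.Label) (a b : stabT x) (p q : Fin (dimR x)) :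
    entry x (a * b) p q = ∑ j, entry x a p j * entry x b j q :=
  (congrFun (congrFun (MatrixIrrep.matrix_mul _ a b) p) q).trans (Matrix.mul_apply ..)

theorem dimR_ne_zero (x : C.Label) : (dimR x : ℂ) ≠ 0 :=
  Nat.cast_ne_zero.2 (C.Γ x.1 x.2).dim_pos.ne'

variable [Fintype G]

/-- Arrows compose exactly when source and target agree, and the loops multiply in `K^{r_T}`: on one
orbit this is the rule for matrices over `ℂ[K^{r_T}]`. -/
theorem zArrow_mul_zArrow (i i' l l' : K ⧸ stab K (C.r T)) (k m : stab K (C.r T)) :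
    C.zArrow T i k i' * C.zArrow T l m l' = if i' = l then C.zArrow T i (k * m) l' else 0 := by
  rw [zArrow, zArrow, zElt_mul_zElt]
  simp only [base_eq_smul_base_iff]
  have h : (C.q T i)⁻¹ * (C.q T i * (k : K) * (C.q T i')⁻¹ * C.q T l) =
      k * ((C.q T i')⁻¹ * C.q T l) := by group
  simp only [h, Subgroup.mul_mem_cancel_left _ k.2, q_inv_mul_q_mem_iff]
  split_ifs with hil
  · subst hil
    simp [zArrow, mul_assoc]
  · rfl

theorem zArrow_mul_zArrow_of_ne {T' : DoubleCoset.Quotient (K : Set G) (K : Set G)} (h : T ≠ T')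
    (i i' : K ⧸ stab K (C.r T)) (k : stab K (C.r T)) (l l' : K ⧸ stab K (C.r T'))
    (m : stab K (C.r T')) : C.zArrow T i k i' * C.zArrow T' l m l' = 0 := by
  rw [zArrow, zArrow, zElt_mul_zElt, if_neg (base_ne_smul_base h _ _ _)]

theorem yElt_zArrow (i i' l l' : K ⧸ stab K (C.r T)) (k m : stab K (C.r T)) :
    yElt (C.base T i) (C.q T i * (k : K) * (C.q T i')⁻¹) (C.zArrow T l m l') =
      if i = l ∧ i' = l' ∧ k = m then 1 else 0 := by
  rw [zArrow, yElt_apply_zElt]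
  refine if_congr ⟨fun h => ?_, ?_⟩ rfl rfl
  · rw [Prod.mk.injEq] at h
    obtain rfl := base_injective h.1
    have h2 : (k : K) * (C.q T i')⁻¹ = m * (C.q T l')⁻¹ := by
      simpa [mul_assoc] using h.2
    have h3 : (C.q T i')⁻¹ * C.q T l' = (k : K)⁻¹ * m := by
      rw [eq_inv_mul_iff_mul_eq, ← mul_assoc, h2]; group
    have h4 : i' = l' := by
      rw [← q_inv_mul_q_mem_iff, h3]
      exact mul_mem (inv_mem k.2) m.2
    subst h4
    exact ⟨rfl, rfl, Subtype.ext (by simpa using h2)⟩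
  · rintro ⟨rfl, rfl, rfl⟩
    rfl

theorem yElt_zArrow_of_ne {T' : DoubleCoset.Quotient (K : Set G) (K : Set G)} (h : T ≠ T')
    (i i' : K ⧸ stab K (C.r T)) (k : stab K (C.r T)) (l l' : K ⧸ stab K (C.r T'))
    (m : stab K (C.r T')) :
    yElt (C.base T i) (C.q T i * (k : K) * (C.q T i')⁻¹) (C.zArrow T' l m l') = 0 := by
  rw [zArrow, yElt_apply_zElt, if_neg]
  intro h'
  exact base_ne_smul_base h i l 1 (by simpa using (Prod.mk.injEq _ _ _ _ ▸ h').1)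

/-! ### Matrix units of the algebra of local operators -/

theorem card_stabT_ne_zero (x : C.Label) : (Nat.card (stabT x) : ℂ) ≠ 0 :=
  Nat.cast_ne_zero.2 Nat.card_pos.ne'

theorem coeff_ne_zero (x : C.Label) : (dimR x : ℂ) / (Nat.card (stabT x) : ℂ) ≠ 0 :=
  div_ne_zero (dimR_ne_zero x) (card_stabT_ne_zero x)

theorem sum_entry_mul_entry (x : C.Label) (p q j l : Fin (dimR x)) :
    ∑ m, entry x m p q * entry x m⁻¹ j l =
      if p = l ∧ q = j then (Nat.card (stabT x) : ℂ) / dimR x else 0 := by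
  rw [Nat.card_eq_fintype_card]
  exact MatrixIrrep.sum_mul_eq (C.Γ x.1 x.2) p q j l

theorem sum_entry_mul_entry_of_ne {R R' : IrrClass (stab K (C.r T))} (h : R ≠ R')
    (p q : Fin (dimR (C := C) ⟨T, R⟩)) (j l : Fin (dimR (C := C) ⟨T, R'⟩)) :
    ∑ m : stab K (C.r T), entry (C := C) ⟨T, R⟩ m p q * entry (C := C) ⟨T, R'⟩ m⁻¹ j l = 0 := by
  refine MatrixIrrep.sum_mul_eq_zero (fun h' => h ?_) p q j l
  rw [← C.mk_Γ T R, ← C.mk_Γ T R']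
  exact (Quotient.sound h').symm

theorem fourier_zArrow (x : C.Label) (p q : Idx x) (i i' : K ⧸ stabT x) (k : stabT x) :
    fourier x p q (C.zArrow x.1 i k i') = if p.1 = i ∧ q.1 = i' then
      (dimR x : ℂ) / (Nat.card (stabT x) : ℂ) * entry x k⁻¹ p.2 q.2 else 0 := by
  rw [fourier, LinearMap.smul_apply, LinearMap.sum_apply, Finset.sum_eq_single k]
  · have := yElt_zArrow p.1 q.1 i i' k k
    rw [base] at this
    rw [LinearMap.smul_apply, MatrixIrrep.matrix_inv, sElt, this]
    by_cases h : p.1 = i ∧ q.1 = i'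
    · simp [h, entry]
    · rw [if_neg h, if_neg (by tauto), smul_zero, smul_zero]
  · intro m _ hm
    have := yElt_zArrow p.1 q.1 i i' m k
    rw [base] at this
    rw [LinearMap.smul_apply, sElt, this, if_neg (by tauto), smul_zero]
  · simp

theorem fourier_zArrow_of_ne (x : C.Label) (h : x.1 ≠ T) (p q : Idx x)
    (i i' : K ⧸ stab K (C.r T)) (k : stab K (C.r T)) :
    fourier x p q (C.zArrow T i k i') = 0 := by
  rw [fourier, LinearMap.smul_apply, LinearMap.sum_apply, Finset.sum_eq_zero, smul_zero]
  intro m _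
  have := yElt_zArrow_of_ne h p.1 q.1 m i i' k
  rw [base] at this
  rw [LinearMap.smul_apply, sElt, this, smul_zero]

/-- The matrix unit of `Z(G,1,K,1)` at the label `x` and the indices `u`, `v`. -/
def matrixUnit (x : C.Label) (u v : Idx x) : LocalAlgebra K :=
  ((dimR x : ℂ) / (Nat.card (stabT x) : ℂ)) •
    ∑ k : stabT x, entry x k u.2 v.2 • C.zArrow x.1 u.1 k v.1

/-- Different `T` have disjoint supports on arrows; for the same `T` this is Schur orthogonality of
inequivalent representations. -/
theorem fourier_matrixUnit_of_ne {x x' : C.Label} (h : x ≠ x') (p q : Idx x) (u v : Idx x') :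
    fourier x p q (matrixUnit x' u v) = 0 := by
  obtain ⟨T, R⟩ := x
  obtain ⟨T', R'⟩ := x'
  simp only [matrixUnit, map_smul, map_sum]
  by_cases hT : T = T'
  · subst hT
    have hR : R' ≠ R := fun h' => h (by rw [h'])
    have key := sum_entry_mul_entry_of_ne hR u.2 v.2 p.2 q.2
    by_cases hpq : p.1 = u.1 ∧ q.1 = v.1
    · have : ∀ k : stab K (C.r T), fourier (C := C) ⟨T, R⟩ p q (C.zArrow T u.1 k v.1) =
          _ * entry (C := C) ⟨T, R⟩ k⁻¹ p.2 q.2 := fun k =>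
        (fourier_zArrow (C := C) ⟨T, R⟩ p q u.1 v.1 k).trans (if_pos hpq)
      simp only [this, smul_eq_mul, mul_left_comm (entry _ _ _ _), ← Finset.mul_sum, key, mul_zero]
    · have : ∀ k : stab K (C.r T), fourier (C := C) ⟨T, R⟩ p q (C.zArrow T u.1 k v.1) = 0 :=
        fun k => (fourier_zArrow (C := C) ⟨T, R⟩ p q u.1 v.1 k).trans (if_neg hpq)
      simp only [this, smul_zero, Finset.sum_const_zero]
  · simp only [fourier_zArrow_of_ne (C := C) ⟨T, R⟩ hT, smul_zero, Finset.sum_const_zero]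

/-- The Fourier element carries `Γ(k⁻¹)` and the matrix unit `Γ(k)`, so orthogonality pairs them
with the representation indices exchanged. This exchange is undone in `dualUnit`. -/
theorem fourier_matrixUnit (x : C.Label) (p q u v : Idx x) :
    fourier x p q (matrixUnit x u v) = if p = (u.1, v.2) ∧ q = (v.1, u.2) then
      (dimR x : ℂ) / (Nat.card (stabT x) : ℂ) else 0 := by
  simp only [matrixUnit, map_smul, map_sum, fourier_zArrow]
  by_cases hpq : p.1 = u.1 ∧ q.1 = v.1
  · simp only [if_pos hpq, smul_eq_mul, mul_left_comm (entry _ _ _ _), ← Finset.mul_sum,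
      sum_entry_mul_entry]
    by_cases h2 : u.2 = q.2 ∧ v.2 = p.2
    · rw [if_pos h2, if_pos ⟨Prod.ext hpq.1 h2.2.symm, Prod.ext hpq.2 h2.1.symm⟩,
        div_mul_div_cancel₀ (card_stabT_ne_zero x), div_self (dimR_ne_zero x), mul_one]
    · rw [if_neg h2, if_neg]
      · simp
      · rintro ⟨rfl, rfl⟩
        exact h2 ⟨rfl, rfl⟩
  · rw [if_neg]
    · simp only [if_neg hpq, smul_zero, Finset.sum_const_zero]
    · rintro ⟨rfl, rfl⟩
      exact hpq ⟨rfl, rfl⟩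

/-- Substituting `n = k m` and splitting `Γ(k⁻¹n)` isolates an orthogonality sum over `k`, which
serves equal and different representations alike. -/
theorem sum_entry_zArrow_mul {R R' : IrrClass (stab K (C.r T))} (u v : Idx (C := C) ⟨T, R⟩)
    (s t : Idx (C := C) ⟨T, R'⟩) :
    (∑ k : stab K (C.r T), entry (C := C) ⟨T, R⟩ k u.2 v.2 • C.zArrow T u.1 k v.1) *
      (∑ k : stab K (C.r T), entry (C := C) ⟨T, R'⟩ k s.2 t.2 • C.zArrow T s.1 k t.1) =
    if v.1 = s.1 then ∑ n : stab K (C.r T), (∑ j, (∑ k : stab K (C.r T),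
      entry (C := C) ⟨T, R⟩ k u.2 v.2 * entry (C := C) ⟨T, R'⟩ k⁻¹ s.2 j) *
        entry (C := C) ⟨T, R'⟩ n j t.2) • C.zArrow T u.1 n t.1 else 0 := by
  rw [Finset.sum_mul]
  simp only [Finset.mul_sum, smul_mul_smul_comm, zArrow_mul_zArrow]
  split_ifs with h
  · have : ∀ k : stab K (C.r T), ∑ m : stab K (C.r T),
        (entry (C := C) ⟨T, R⟩ k u.2 v.2 * entry (C := C) ⟨T, R'⟩ m s.2 t.2) •
          C.zArrow T u.1 (k * m) t.1 =
        ∑ n : stab K (C.r T), (entry (C := C) ⟨T, R⟩ k u.2 v.2 *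
          entry (C := C) ⟨T, R'⟩ (k⁻¹ * n) s.2 t.2) • C.zArrow T u.1 n t.1 := fun k =>
      Fintype.sum_equiv (Equiv.mulLeft k) _ _ fun m => by
        rw [Equiv.coe_mulLeft, inv_mul_cancel_left]
    simp only [this]
    rw [Finset.sum_comm]
    refine Finset.sum_congr rfl fun n _ => ?_
    rw [← Finset.sum_smul]
    congr 1
    simp only [Finset.sum_mul]
    rw [Finset.sum_comm]
    refine Finset.sum_congr rfl fun k _ => ?_
    have := entry_mul (C := C) ⟨T, R'⟩ k⁻¹ n s.2 t.2
    simp only [mul_assoc, ← Finset.mul_sum] at this ⊢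
    rw [this]
  · simp only [smul_zero, Finset.sum_const_zero]

theorem matrixUnit_mul_of_ne {x x' : C.Label} (h : x ≠ x') (u v : Idx x) (s t : Idx x') :
    matrixUnit x u v * matrixUnit x' s t = 0 := by
  obtain ⟨T, R⟩ := x
  obtain ⟨T', R'⟩ := x'
  rw [matrixUnit, matrixUnit, smul_mul_smul_comm]
  by_cases hT : T = T'
  · subst hT
    have hR : R ≠ R' := fun h' => h (by rw [h'])
    have := sum_entry_zArrow_mul u v s t
    simp only [sum_entry_mul_entry_of_ne hR, zero_mul, Finset.sum_const_zero, zero_smul,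
      ite_self] at this
    rw [this, smul_zero]
  · rw [Finset.sum_mul]
    simp only [Finset.mul_sum, smul_mul_smul_comm, zArrow_mul_zArrow_of_ne hT, smul_zero,
      Finset.sum_const_zero]

theorem matrixUnit_mul (x : C.Label) (u v s t : Idx x) :
    matrixUnit x u v * matrixUnit x s t = if v = s then matrixUnit x u t else 0 := by
  have h := sum_entry_zArrow_mul (C := C) (R := x.2) (R' := x.2) u v s t
  simp only [sum_entry_mul_entry] at h
  rw [matrixUnit, matrixUnit, smul_mul_smul_comm, h]
  by_cases hvs : v.1 = s.1
  · rw [if_pos hvs]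
    by_cases h2 : v.2 = s.2
    · rw [if_pos (Prod.ext hvs h2), matrixUnit, mul_smul]
      congr 1
      rw [Finset.smul_sum]
      refine Finset.sum_congr rfl fun n _ => ?_
      rw [smul_smul]
      congr 1
      simp only [h2, and_true, ite_mul, zero_mul, Finset.sum_ite_eq, Finset.mem_univ, if_true]
      rw [← mul_assoc, div_mul_div_cancel₀ (card_stabT_ne_zero x), div_self (dimR_ne_zero x),
        one_mul]
    · rw [if_neg fun h => h2 (by rw [h])]
      simp only [h2, and_false, if_false, zero_mul, Finset.sum_const_zero, zero_smul, smul_zero]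
  · rw [if_neg hvs, if_neg fun h => hvs (by rw [h]), smul_zero]

/-- A functional that vanishes on the matrix units is zero. -/
theorem eq_zero_of_matrixUnit (C : FourierChoice K) {y : RibbonAlgebra K}
    (h : ∀ (x : C.Label) (u v : Idx x), y (matrixUnit x u v) = 0) : y = 0 := by
  refine RibbonAlgebra.ext_zElt fun c k => ?_
  obtain ⟨T, i, i', m, rfl, rfl⟩ := exists_eq_base (C := C) c k
  -- For fixed endpoints `y` is a function on `K^{r_T}`, and its values on the matrix units are its
  -- Fourier coefficients up to nonzero factors.
  have hf : (fun m : stab K (C.r T) => y (C.zArrow T i m i')) = 0 := by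
    refine eq_zero_of_sum_smul_rep_eq_zero _ fun Γ => ?_
    -- The hypothesis concerns only the chosen matrix forms; `e` transports the vanishing to an
    -- arbitrary form in the same class.
    obtain ⟨e⟩ : Nonempty (Representation.Equiv (C.Γ T (Quotient.mk _ Γ)).rep Γ.rep) :=
      Quotient.exact (C.mk_Γ T (Quotient.mk _ Γ))
    set Γ' := C.Γ T (Quotient.mk _ Γ) with hΓ'
    have h0 : ∑ k, y (C.zArrow T i k i') • Γ'.rep k = 0 := by
      apply LinearMap.toMatrix'.injective
      ext p q
      have := h ⟨T, Quotient.mk _ Γ⟩ (i, p) (i', q)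
      rw [matrixUnit, map_smul, smul_eq_zero_iff_right (coeff_ne_zero _), map_sum] at this
      simp only [map_sum, map_smul, map_zero, Matrix.sum_apply, Matrix.smul_apply,
        Matrix.zero_apply, smul_eq_mul] at this ⊢
      refine Eq.trans ?_ this
      exact Finset.sum_congr rfl fun k _ => mul_comm _ _
    refine LinearMap.ext fun w => ?_
    have h1 := congrArg e (LinearMap.congr_fun h0 (e.symm w))
    have he : ∀ k v, e (Γ'.rep k v) = Γ.rep k (e v) := e.toIntertwiningMap.isIntertwining
    simpa [LinearMap.sum_apply, map_sum, he] using h1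
  exact congrFun hf m

end FourierChoice
end Coordinates
-- Excitations as spaces of functionals on matrix blocks and rows
section Excitations

variable {G : Type*} [Group G] [Fintype G] {K : Subgroup G}

theorem actEnd_apply (z w : LocalAlgebra K) (y : RibbonAlgebra K) : actEnd z y w = y (w * z) := rfl

theorem actStart_apply (z w : LocalAlgebra K) (y : RibbonAlgebra K) :
    actStart z y w = y (z * w) := rfl

namespace FourierChoice

variable {C : FourierChoice K}

instance (x : C.Label) : Nonempty (Fin (dimR x)) := ⟨⟨0, (C.Γ x.1 x.2).dim_pos⟩⟩

theorem ext_matrixUnit (C : FourierChoice K) {y y' : RibbonAlgebra K}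
    (h : ∀ (x : C.Label) (u v : Idx x), y (matrixUnit x u v) = y' (matrixUnit x u v)) :
    y = y' :=
  sub_eq_zero.1 <| eq_zero_of_matrixUnit C fun x u v => by
    rw [LinearMap.sub_apply, h, sub_self]

/-- The multiple of the functional dual to the matrix unit `u`, `v` at `x` among the `fourier x`. -/
def dualUnit (x : C.Label) (u v : Idx x) : RibbonAlgebra K := fourier x (u.1, v.2) (v.1, u.2)

theorem dualUnit_matrixUnit_of_ne {x x' : C.Label} (h : x ≠ x') (p q : Idx x) (u v : Idx x') :
    dualUnit x p q (matrixUnit x' u v) = 0 :=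
  fourier_matrixUnit_of_ne h _ _ _ _

theorem dualUnit_matrixUnit (x : C.Label) (p q u v : Idx x) :
    dualUnit x p q (matrixUnit x u v) = if p = u ∧ q = v then
      (dimR x : ℂ) / (Nat.card (stabT x) : ℂ) else 0 := by
  rw [dualUnit, fourier_matrixUnit]
  refine if_congr ?_ rfl rfl
  simp only [Prod.ext_iff]
  tauto

theorem linearIndependent_dualUnit (C : FourierChoice K) :
    LinearIndependent ℂ fun a : Σ x : C.Label, Idx x × Idx x => dualUnit a.1 a.2.1 a.2.2 := by
  rw [linearIndependent_iff']
  intro s g hg ⟨x, u, v⟩ hi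
  have h := LinearMap.congr_fun hg (matrixUnit x u v)
  rw [LinearMap.sum_apply, Finset.sum_eq_single ⟨x, u, v⟩] at h
  · rw [LinearMap.smul_apply, dualUnit_matrixUnit, if_pos ⟨rfl, rfl⟩] at h
    exact (mul_eq_zero.1 h).resolve_right (coeff_ne_zero x)
  · rintro ⟨x', p, q⟩ _ hne
    rw [LinearMap.smul_apply]
    by_cases hx : x' = x
    · subst hx
      rw [dualUnit_matrixUnit, if_neg, smul_zero]
      rintro ⟨rfl, rfl⟩
      exact hne rfl
    · rw [dualUnit_matrixUnit_of_ne hx, smul_zero]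
  · exact fun h => absurd hi h

instance : FiniteDimensional ℂ (LocalAlgebra K) :=
  inferInstanceAs (FiniteDimensional ℂ ((G ⧸ K) × K → ℂ))

instance finite_index (C : FourierChoice K) : Finite (Σ x : C.Label, Idx x × Idx x) :=
  (linearIndependent_dualUnit C).finite

/-- Finiteness of the set of irreducible representations comes from the linear independence of the
dual units in a finite-dimensional space. -/
instance finite_label (C : FourierChoice K) : Finite C.Label :=
  Finite.of_surjective (fun a : Σ x : C.Label, Idx x × Idx x => a.1) fun x =>
    ⟨⟨x, Classical.arbitrary _⟩, rfl⟩

instance (C : FourierChoice K) : Fintype C.Label := Fintype.ofFinite _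

theorem eq_sum_dualUnit (C : FourierChoice K) (y : RibbonAlgebra K) :
    y = ∑ x : C.Label, ∑ u : Idx x, ∑ v : Idx x,
      (y (matrixUnit x u v) / ((dimR x : ℂ) / (Nat.card (stabT x) : ℂ))) • dualUnit x u v := by
  refine ext_matrixUnit C fun x u v => ?_
  simp only [LinearMap.sum_apply, LinearMap.smul_apply]
  rw [Finset.sum_eq_single x, Finset.sum_eq_single u, Finset.sum_eq_single v]
  · rw [dualUnit_matrixUnit, if_pos ⟨rfl, rfl⟩, smul_eq_mul, div_mul_cancel₀ _ (coeff_ne_zero x)]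
  · intro q _ hq
    rw [dualUnit_matrixUnit, if_neg (fun h => hq h.2), smul_zero]
  · simp
  · intro p _ hp
    refine Finset.sum_eq_zero fun q _ => ?_
    rw [dualUnit_matrixUnit, if_neg (fun h => hp h.1), smul_zero]
  · simp
  · intro x' _ hx
    refine Finset.sum_eq_zero fun p _ => Finset.sum_eq_zero fun q _ => ?_
    rw [dualUnit_matrixUnit_of_ne hx, smul_zero]
  · simp

theorem span_dualUnit (C : FourierChoice K) :
    Submodule.span ℂ (Set.range fun a : Σ x : C.Label, Idx x × Idx x =>
      dualUnit a.1 a.2.1 a.2.2) = ⊤ := by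
  refine eq_top_iff.2 fun y _ => ?_
  rw [eq_sum_dualUnit C y]
  exact Submodule.sum_mem _ fun x _ => Submodule.sum_mem _ fun u _ => Submodule.sum_mem _ fun v _ =>
    Submodule.smul_mem _ _ (Submodule.subset_span ⟨⟨x, u, v⟩, rfl⟩)

/-! ### The blocks in terms of matrix units -/

theorem dualUnit_mem_block (x : C.Label) (u v : Idx x) : dualUnit x u v ∈ block x :=
  Submodule.subset_span ⟨((u.1, v.2), (v.1, u.2)), rfl⟩

theorem dualUnit_mem_endBlock (x : C.Label) (u v : Idx x) :
    dualUnit x u v ∈ endBlock x u.1 u.2 :=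
  Submodule.subset_span ⟨(v.1, v.2), rfl⟩

theorem mem_block_iff (x : C.Label) (y : RibbonAlgebra K) :
    y ∈ block x ↔ ∀ x' : C.Label, x' ≠ x → ∀ u v : Idx x', y (matrixUnit x' u v) = 0 := by
  refine ⟨fun hy x' hx u v => ?_, fun h => ?_⟩
  · induction hy using Submodule.span_induction with
    | mem y hy =>
      obtain ⟨p, rfl⟩ := hy
      exact fourier_matrixUnit_of_ne hx.symm _ _ _ _
    | zero => rfl
    | add y y' _ _ h h' => rw [LinearMap.add_apply, h, h', add_zero]
    | smul a y _ h => rw [LinearMap.smul_apply, h, smul_zero]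
  · rw [eq_sum_dualUnit C y]
    refine Submodule.sum_mem _ fun x' _ => Submodule.sum_mem _ fun u _ =>
      Submodule.sum_mem _ fun v _ => ?_
    by_cases hx : x' = x
    · subst hx
      exact Submodule.smul_mem _ _ (dualUnit_mem_block x' u v)
    · rw [h x' hx, zero_div, zero_smul]
      exact Submodule.zero_mem _

/-- After the exchange of representation indices the fixed pair `(i, j')` is a row index of matrix
units: these are the functionals supported on one row. -/
theorem mem_endBlock_iff (x : C.Label) (u : Idx x) (y : RibbonAlgebra K) :
    y ∈ endBlock x u.1 u.2 ↔
      (∀ x' : C.Label, x' ≠ x → ∀ s t : Idx x', y (matrixUnit x' s t) = 0) ∧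
        ∀ s t : Idx x, s ≠ u → y (matrixUnit x s t) = 0 := by
  constructor
  · intro hy
    induction hy using Submodule.span_induction with
    | mem y hy =>
      obtain ⟨p, rfl⟩ := hy
      refine ⟨fun x' hx s t => fourier_matrixUnit_of_ne hx.symm _ _ _ _, fun s t hs => ?_⟩
      exact (dualUnit_matrixUnit x u p s t).trans (if_neg fun h => hs h.1.symm)
    | zero => exact ⟨fun _ _ _ _ => rfl, fun _ _ _ => rfl⟩
    | add y y' _ _ h h' =>
      exact ⟨fun x' hx s t => by rw [LinearMap.add_apply, h.1 x' hx, h'.1 x' hx, add_zero],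
        fun s t hs => by rw [LinearMap.add_apply, h.2 s t hs, h'.2 s t hs, add_zero]⟩
    | smul a y _ h =>
      exact ⟨fun x' hx s t => by rw [LinearMap.smul_apply, h.1 x' hx, smul_zero],
        fun s t hs => by rw [LinearMap.smul_apply, h.2 s t hs, smul_zero]⟩
  · intro h
    rw [eq_sum_dualUnit C y]
    refine Submodule.sum_mem _ fun x' _ => Submodule.sum_mem _ fun s _ =>
      Submodule.sum_mem _ fun t _ => ?_
    by_cases hx : x' = x
    · subst hx
      by_cases hs : s = u
      · subst hs
        exact Submodule.smul_mem _ _ (dualUnit_mem_endBlock x' s t)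
      · rw [h.2 s t hs, zero_div, zero_smul]
        exact Submodule.zero_mem _
    · rw [h.1 x' hx, zero_div, zero_smul]
      exact Submodule.zero_mem _

/-- A functional that vanishes on a row of matrix units vanishes on the right ideal it spans. -/
theorem apply_matrixUnit_mul {y : RibbonAlgebra K} {x : C.Label} {u : Idx x}
    (h : ∀ v, y (matrixUnit x u v) = 0) (v : Idx x) (z : LocalAlgebra K) :
    y (matrixUnit x u v * z) = 0 := by
  have : actStart (matrixUnit x u v) y = 0 := eq_zero_of_matrixUnit C fun x' s t => by
    rw [actStart_apply]
    by_cases hx : x = x'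
    · subst hx
      rw [matrixUnit_mul]
      split_ifs
      · exact h t
      · exact map_zero y
    · rw [matrixUnit_mul_of_ne hx, map_zero]
  exact LinearMap.congr_fun this z

/-- A functional that vanishes on a column of matrix units vanishes on the left ideal it spans. -/
theorem apply_mul_matrixUnit {y : RibbonAlgebra K} {x : C.Label} {v : Idx x}
    (h : ∀ u, y (matrixUnit x u v) = 0) (u : Idx x) (z : LocalAlgebra K) :
    y (z * matrixUnit x u v) = 0 := by
  have : actEnd (matrixUnit x u v) y = 0 := eq_zero_of_matrixUnit C fun x' s t => by
    rw [actEnd_apply]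
    by_cases hx : x' = x
    · subst hx
      rw [matrixUnit_mul]
      split_ifs
      · exact h s
      · exact map_zero y
    · rw [matrixUnit_mul_of_ne hx, map_zero]
  exact LinearMap.congr_fun this z

/-- The block is the annihilator of a two-sided ideal, the sum of the other matrix blocks. -/
theorem block_isLocallyStable (x : C.Label) : IsLocallyStable (block x) := by
  intro z y hy
  rw [mem_block_iff] at hy
  refine ⟨(mem_block_iff _ _).2 fun x' hx u v => ?_, (mem_block_iff _ _).2 fun x' hx u v => ?_⟩
  · exact apply_matrixUnit_mul (hy x' hx u) v z
  · exact apply_mul_matrixUnit (fun u => hy x' hx u v) u z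

theorem endBlock_isStableAtEnd (x : C.Label) (i : K ⧸ stabT x) (j : Fin (dimR x)) :
    IsStableAtEnd (endBlock x i j) := by
  intro z y hy
  have hy' := (mem_endBlock_iff x (i, j) y).1 hy
  refine (mem_endBlock_iff x (i, j) _).2 ⟨fun x' hx s t => ?_, fun s t hs => ?_⟩
  · exact apply_matrixUnit_mul (hy'.1 x' hx s) t z
  · exact apply_matrixUnit_mul (fun t => hy'.2 s t hs) t z

theorem dualUnit_ne_zero (x : C.Label) (u v : Idx x) : dualUnit x u v ≠ 0 := by
  intro h
  have h1 := dualUnit_matrixUnit x u v u v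
  rw [h, if_pos ⟨rfl, rfl⟩] at h1
  exact coeff_ne_zero x h1.symm

theorem block_ne_bot (x : C.Label) : block x ≠ ⊥ := fun h =>
  dualUnit_ne_zero x (Classical.arbitrary _) (Classical.arbitrary _)
    ((Submodule.mem_bot ℂ).1 (h ▸ dualUnit_mem_block x _ _))

theorem endBlock_ne_bot (x : C.Label) (i : K ⧸ stabT x) (j : Fin (dimR x)) : endBlock x i j ≠ ⊥ :=
  fun h => dualUnit_ne_zero x (i, j) (i, j)
    ((Submodule.mem_bot ℂ).1 (h ▸ dualUnit_mem_endBlock x (i, j) _))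

theorem exists_matrixUnit_ne_zero (C : FourierChoice K) {y : RibbonAlgebra K} (hy : y ≠ 0) :
    ∃ (x : C.Label) (u v : Idx x), y (matrixUnit x u v) ≠ 0 := by
  by_contra! h
  exact hy (eq_zero_of_matrixUnit C h)

/-- Simplicity of the bimodule: multiplying the argument of `y` by `e_{us}` on the left and `e_{tv}`
on the right leaves only its entry at `(s,t)`, with value `y(e_{uv})`. One nonzero entry thus yields
every dual unit of the block. -/
theorem block_le {W : Submodule ℂ (RibbonAlgebra K)} (hW : IsLocallyStable W)
    {y : RibbonAlgebra K} (hy : y ∈ W) {x : C.Label} {u v : Idx x}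
    (h : y (matrixUnit x u v) ≠ 0) : block x ≤ W := by
  have key : ∀ s t, dualUnit x s t ∈ W := by
    intro s t
    have hmem := (hW (matrixUnit x t v) _ (hW (matrixUnit x u s) y hy).2).1
    have : actEnd (matrixUnit x t v) (actStart (matrixUnit x u s) y) =
        (y (matrixUnit x u v) / ((dimR x : ℂ) / (Nat.card (stabT x) : ℂ))) • dualUnit x s t := by
      refine ext_matrixUnit C fun x' a b => ?_
      rw [actEnd_apply, actStart_apply, LinearMap.smul_apply]
      by_cases hx : x = x'
      · subst hx
        rw [dualUnit_matrixUnit, matrixUnit_mul]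
        by_cases hb : b = t
        · rw [if_pos hb, matrixUnit_mul]
          by_cases ha : s = a
          · rw [if_pos ha, if_pos ⟨ha, hb.symm⟩, smul_eq_mul, div_mul_cancel₀ _ (coeff_ne_zero x)]
          · rw [if_neg ha, if_neg fun h => ha h.1, map_zero, smul_zero]
        · rw [if_neg hb, if_neg fun h => hb h.2.symm, mul_zero, map_zero, smul_zero]
      · rw [matrixUnit_mul_of_ne (Ne.symm hx), mul_zero, map_zero, dualUnit_matrixUnit_of_ne hx,
          smul_zero]
    rw [this] at hmem
    exact (W.smul_mem_iff (div_ne_zero h (coeff_ne_zero x))).1 hmem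
  refine Submodule.span_le.2 ?_
  rintro _ ⟨p, rfl⟩
  exact key (p.1.1, p.2.2) (p.2.1, p.1.2)

/-- Simplicity of a row: the row index is already fixed, so right multiplication by `e_{tv}` alone
moves a nonzero entry to every column. -/
theorem endBlock_le {W : Submodule ℂ (RibbonAlgebra K)} (hW : IsStableAtEnd W)
    {x : C.Label} {i : K ⧸ stabT x} {j : Fin (dimR x)} {y : RibbonAlgebra K} (hy : y ∈ W)
    (hy' : y ∈ endBlock x i j) (h0 : y ≠ 0) : endBlock x i j ≤ W := by
  obtain ⟨h1, h2⟩ := (mem_endBlock_iff x (i, j) y).1 hy'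
  obtain ⟨x', u, v, h⟩ := exists_matrixUnit_ne_zero C h0
  obtain rfl : x' = x := by
    by_contra hx
    exact h (h1 x' hx u v)
  obtain rfl : u = (i, j) := by
    by_contra hu
    exact h (h2 u v hu)
  refine Submodule.span_le.2 ?_
  rintro _ ⟨t, rfl⟩
  have hmem := hW (matrixUnit x' t v) y hy
  have : actEnd (matrixUnit x' t v) y = (y (matrixUnit x' (i, j) v) /
      ((dimR x' : ℂ) / (Nat.card (stabT x') : ℂ))) • dualUnit x' (i, j) t := by
    refine ext_matrixUnit C fun x a b => ?_
    rw [actEnd_apply, LinearMap.smul_apply]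
    by_cases hx : x' = x
    · subst hx
      rw [dualUnit_matrixUnit, matrixUnit_mul]
      by_cases hb : b = t
      · rw [if_pos hb]
        by_cases ha : a = (i, j)
        · rw [if_pos ⟨ha.symm, hb.symm⟩, smul_eq_mul, div_mul_cancel₀ _ (coeff_ne_zero x'), ha]
        · rw [if_neg fun h => ha h.1.symm, h2 a v ha, smul_zero]
      · rw [if_neg hb, if_neg fun h => hb h.2.symm, map_zero, smul_zero]
    · rw [matrixUnit_mul_of_ne (Ne.symm hx), map_zero, dualUnit_matrixUnit_of_ne hx, smul_zero]
  rw [this] at hmem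
  exact (W.smul_mem_iff (div_ne_zero h (coeff_ne_zero x'))).1 hmem

/-! ### Elementary excitations -/

theorem block_isElementaryExcitation (x : C.Label) : IsElementaryExcitation (block x) := by
  refine ⟨block_ne_bot x, block_isLocallyStable x, fun W₁ W₂ h₁ h₂ hsup hinf => ?_⟩
  have key : ∀ W, IsLocallyStable W → W ≤ block x → W ≠ ⊥ → block x ≤ W := by
    intro W hW hle hne
    obtain ⟨y, hy, hy0⟩ := W.exists_mem_ne_zero_of_ne_bot hne
    obtain ⟨x', u, v, h⟩ := exists_matrixUnit_ne_zero C hy0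
    obtain rfl : x' = x := by
      by_contra hx
      exact h ((mem_block_iff x y).1 (hle hy) x' hx u v)
    exact block_le hW hy h
  by_contra! hne
  refine block_ne_bot x (eq_bot_iff.2 (hinf ▸ le_inf ?_ ?_))
  · exact key W₁ h₁ (hsup ▸ le_sup_left) hne.1
  · exact key W₂ h₂ (hsup ▸ le_sup_right) hne.2

theorem endBlock_isElementaryExcitationAtEnd (x : C.Label) (i : K ⧸ stabT x)
    (j : Fin (dimR x)) : IsElementaryExcitationAtEnd (endBlock x i j) := by
  refine ⟨endBlock_ne_bot x i j, endBlock_isStableAtEnd x i j, fun W₁ W₂ h₁ h₂ hsup hinf => ?_⟩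
  have key : ∀ W, IsStableAtEnd W → W ≤ endBlock x i j → W ≠ ⊥ → endBlock x i j ≤ W := by
    intro W hW hle hne
    obtain ⟨y, hy, hy0⟩ := W.exists_mem_ne_zero_of_ne_bot hne
    exact endBlock_le hW hy (hle hy) hy0
  by_contra! hne
  refine endBlock_ne_bot x i j (eq_bot_iff.2 (hinf ▸ le_inf ?_ ?_))
  · exact key W₁ h₁ (hsup ▸ le_sup_left) hne.1
  · exact key W₂ h₂ (hsup ▸ le_sup_right) hne.2

/-- A nonzero entry puts a whole block into `W`. The functionals in `W` that vanish on this matrix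
block form a stable complement, which indecomposability forces to be zero. -/
theorem exists_eq_block (C : FourierChoice K) {W : Submodule ℂ (RibbonAlgebra K)}
    (hW : IsElementaryExcitation W) : ∃ x : C.Label, block x = W := by
  obtain ⟨hne, hst, hind⟩ := hW
  obtain ⟨y, hy, hy0⟩ := W.exists_mem_ne_zero_of_ne_bot hne
  obtain ⟨x, u, v, h⟩ := exists_matrixUnit_ne_zero C hy0
  have hle : block x ≤ W := block_le hst hy h
  let W₂ : Submodule ℂ (RibbonAlgebra K) :=
    { carrier := {w | w ∈ W ∧ ∀ s t : Idx x, w (matrixUnit x s t) = 0}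
      add_mem' := fun ha hb => ⟨W.add_mem ha.1 hb.1, fun s t => by
        rw [LinearMap.add_apply, ha.2, hb.2, add_zero]⟩
      zero_mem' := ⟨W.zero_mem, fun _ _ => rfl⟩
      smul_mem' := fun c a ha => ⟨W.smul_mem c ha.1, fun s t => by
        rw [LinearMap.smul_apply, ha.2, smul_zero]⟩ }
  have hW₂ : IsLocallyStable W₂ := fun z w hw =>
    ⟨⟨(hst z w hw.1).1, fun s t => apply_matrixUnit_mul (hw.2 s) t z⟩,
      ⟨(hst z w hw.1).2, fun s t => apply_mul_matrixUnit (fun s => hw.2 s t) s z⟩⟩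
  have hsup : block x ⊔ W₂ = W := by
    refine le_antisymm (sup_le hle fun w hw => hw.1) fun w hw => ?_
    let w₁ : RibbonAlgebra K := ∑ s : Idx x, ∑ t : Idx x,
      (w (matrixUnit x s t) / ((dimR x : ℂ) / (Nat.card (stabT x) : ℂ))) • dualUnit x s t
    have hw₁ : w₁ ∈ block x := Submodule.sum_mem _ fun s _ => Submodule.sum_mem _ fun t _ =>
      Submodule.smul_mem _ _ (dualUnit_mem_block x s t)
    refine Submodule.mem_sup.2 ⟨w₁, hw₁, w - w₁, ⟨W.sub_mem hw (hle hw₁), fun s t => ?_⟩, by abel⟩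
    rw [LinearMap.sub_apply, sub_eq_zero]
    simp only [w₁, LinearMap.sum_apply, LinearMap.smul_apply]
    rw [Finset.sum_eq_single s, Finset.sum_eq_single t]
    · rw [dualUnit_matrixUnit, if_pos ⟨rfl, rfl⟩, smul_eq_mul,
        div_mul_cancel₀ _ (coeff_ne_zero x)]
    · intro q _ hq
      rw [dualUnit_matrixUnit, if_neg (fun h => hq h.2), smul_zero]
    · simp
    · intro p _ hp
      refine Finset.sum_eq_zero fun q _ => ?_
      rw [dualUnit_matrixUnit, if_neg (fun h => hp h.1), smul_zero]
    · simp
  have hinf : block x ⊓ W₂ = ⊥ := by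
    refine eq_bot_iff.2 fun w hw => (Submodule.mem_bot ℂ).2 (eq_zero_of_matrixUnit C fun x' s t => ?_)
    by_cases hx : x' = x
    · subst hx
      exact hw.2.2 s t
    · exact (mem_block_iff x w).1 hw.1 x' hx s t
  have h₂ := (hind _ _ (block_isLocallyStable x) hW₂ hsup hinf).resolve_left (block_ne_bot x)
  exact ⟨x, by rw [← hsup, h₂, sup_bot_eq]⟩

theorem block_injective : Function.Injective fun x : C.Label => block x := by
  intro x x' h
  by_contra hne
  obtain ⟨u⟩ : Nonempty (Idx x) := inferInstance
  have h1 : dualUnit x u u ∈ block x' := (show block x = block x' from h) ▸ dualUnit_mem_block x u u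
  have h2 := (mem_block_iff x' _).1 h1 x hne u u
  rw [dualUnit_matrixUnit, if_pos ⟨rfl, rfl⟩] at h2
  exact coeff_ne_zero x h2

/-- A functional separating the product from the span of the column would vanish on the column but
not on the left ideal it generates. -/
theorem mul_matrixUnit_mem (z : LocalAlgebra K) (x : C.Label) (t v : Idx x) :
    z * matrixUnit x t v ∈ Submodule.span ℂ (Set.range fun s => matrixUnit x s v) := by
  set S := Submodule.span ℂ (Set.range fun s => matrixUnit x s v)
  by_contra hz
  obtain ⟨y, hy, hS⟩ := S.exists_dual_map_eq_bot_of_notMem hz inferInstance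
  refine hy (apply_mul_matrixUnit (fun u => ?_) t z)
  have : y (matrixUnit x u v) ∈ S.map y :=
    Submodule.mem_map_of_mem (Submodule.subset_span ⟨u, rfl⟩)
  rwa [hS, Submodule.mem_bot] at this

/-- An elementary excitation at the last cilium on which the functionals do not all vanish at a
matrix unit `u`, `v` of the label `x` contains no nonzero functional vanishing on the row `u`. -/
theorem eq_zero_of_row {W : Submodule ℂ (RibbonAlgebra K)} (hW : IsElementaryExcitationAtEnd W)
    {y : RibbonAlgebra K} (hy : y ∈ W) {x : C.Label} {u v : Idx x}
    (h : y (matrixUnit x u v) ≠ 0) {w : RibbonAlgebra K} (hw : w ∈ W)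
    (hrow : ∀ t, w (matrixUnit x u t) = 0) : w = 0 := by
  obtain ⟨-, hst, hind⟩ := hW
  let W₂ : Submodule ℂ (RibbonAlgebra K) :=
    { carrier := {w | w ∈ W ∧ ∀ t : Idx x, w (matrixUnit x u t) = 0}
      add_mem' := fun ha hb => ⟨W.add_mem ha.1 hb.1, fun t => by
        rw [LinearMap.add_apply, ha.2, hb.2, add_zero]⟩
      zero_mem' := ⟨W.zero_mem, fun _ => rfl⟩
      smul_mem' := fun c a ha => ⟨W.smul_mem c ha.1, fun t => by
        rw [LinearMap.smul_apply, ha.2, smul_zero]⟩ }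
  have hW₂ : IsStableAtEnd W₂ := fun z w hw =>
    ⟨hst z w hw.1, fun t => apply_matrixUnit_mul hw.2 t z⟩
  -- The submodule generated by `e_{vv} ▷ y`. It may be spread over several rows, but evaluation on
  -- row `u` is injective on it and reaches all values, so the kernel `W₂` of this evaluation in `W`
  -- is a complement.
  let W₁ : Submodule ℂ (RibbonAlgebra K) :=
    Submodule.span ℂ (Set.range fun t => actEnd (matrixUnit x t v) y)
  have hle : W₁ ≤ W := Submodule.span_le.2 (by rintro _ ⟨t, rfl⟩; exact hst _ y hy)
  have hmem : ∀ e ∈ Submodule.span ℂ (Set.range fun s => matrixUnit x s v), actEnd e y ∈ W₁ := by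
    intro e he
    induction he using Submodule.span_induction with
    | mem e he =>
      obtain ⟨s, rfl⟩ := he
      exact Submodule.subset_span ⟨s, rfl⟩
    | zero =>
      have : actEnd (0 : LocalAlgebra K) y = 0 :=
        LinearMap.ext fun z => by rw [actEnd_apply, mul_zero, map_zero]; rfl
      exact this ▸ W₁.zero_mem
    | add e e' _ _ h h' =>
      have : actEnd (e + e') y = actEnd e y + actEnd e' y :=
        LinearMap.ext fun z => by
          rw [LinearMap.add_apply, actEnd_apply, actEnd_apply, actEnd_apply, mul_add, map_add]
      exact this ▸ W₁.add_mem h h'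
    | smul a e _ h =>
      have : actEnd (a • e) y = a • actEnd e y :=
        LinearMap.ext fun z => by
          rw [LinearMap.smul_apply, actEnd_apply, actEnd_apply, mul_smul_comm, map_smul]
      exact this ▸ W₁.smul_mem a h
  have hW₁ : IsStableAtEnd W₁ := by
    intro z w hw
    induction hw using Submodule.span_induction with
    | mem w hw =>
      obtain ⟨t, rfl⟩ := hw
      have : actEnd z (actEnd (matrixUnit x t v) y) = actEnd (z * matrixUnit x t v) y :=
        LinearMap.ext fun z' => by simp only [actEnd_apply, mul_assoc]
      exact this ▸ hmem _ (mul_matrixUnit_mem z x t v)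
    | zero =>
      have : actEnd z (0 : RibbonAlgebra K) = 0 := LinearMap.ext fun _ => rfl
      exact this ▸ W₁.zero_mem
    | add w w' _ _ h h' =>
      have : actEnd z (w + w') = actEnd z w + actEnd z w' := LinearMap.ext fun _ => rfl
      exact this ▸ W₁.add_mem h h'
    | smul a w _ h =>
      have : actEnd z (a • w) = a • actEnd z w := LinearMap.ext fun _ => rfl
      exact this ▸ W₁.smul_mem a h
  have hval : ∀ (d : Idx x → ℂ) (b : Idx x),
      (∑ t, d t • actEnd (matrixUnit x t v) y) (matrixUnit x u b) =
        d b * y (matrixUnit x u v) := by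
    intro d b
    rw [LinearMap.sum_apply, Finset.sum_eq_single b]
    · rw [LinearMap.smul_apply, actEnd_apply, matrixUnit_mul, if_pos rfl, smul_eq_mul]
    · intro t _ ht
      rw [LinearMap.smul_apply, actEnd_apply, matrixUnit_mul, if_neg (Ne.symm ht), map_zero,
        smul_zero]
    · simp
  have hsup : W₁ ⊔ W₂ = W := by
    refine le_antisymm (sup_le hle fun w hw => hw.1) fun w hw => ?_
    let w₁ : RibbonAlgebra K := ∑ t : Idx x,
      (w (matrixUnit x u t) / y (matrixUnit x u v)) • actEnd (matrixUnit x t v) y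
    have hw₁ : w₁ ∈ W₁ := Submodule.sum_mem _ fun t _ =>
      Submodule.smul_mem _ _ (Submodule.subset_span ⟨t, rfl⟩)
    refine Submodule.mem_sup.2 ⟨w₁, hw₁, w - w₁, ⟨W.sub_mem hw (hle hw₁), fun t => ?_⟩, by abel⟩
    rw [LinearMap.sub_apply, hval, div_mul_cancel₀ _ h, sub_self]
  have hinf : W₁ ⊓ W₂ = ⊥ := by
    refine eq_bot_iff.2 fun w hw => (Submodule.mem_bot ℂ).2 ?_
    obtain ⟨d, rfl⟩ := (Submodule.mem_span_range_iff_exists_fun ℂ).1 hw.1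
    refine Finset.sum_eq_zero fun t _ => ?_
    have := hw.2.2 t
    rw [hval] at this
    rw [(mul_eq_zero.1 this).resolve_right h, zero_smul]
  rcases hind _ _ hW₁ hW₂ hsup hinf with h₁ | h₂
  · exfalso
    have h0 : actEnd (matrixUnit x v v) y ∈ W₁ := Submodule.subset_span ⟨v, rfl⟩
    rw [h₁, Submodule.mem_bot] at h0
    have := LinearMap.congr_fun h0 (matrixUnit x u v)
    rw [actEnd_apply, matrixUnit_mul, if_pos rfl] at this
    exact h this
  · exact (Submodule.mem_bot ℂ).1 (h₂ ▸ (show w ∈ W₂ from ⟨hw, hrow⟩))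

/-- Left multiplication of the argument by `e_{u,(i,j)}` moves row `u` to row `(i,j)` and commutes
with the action at the last cilium. It is injective on `W` by `eq_zero_of_row` and onto because a
row is simple. -/
theorem sameCharge_endBlock {W : Submodule ℂ (RibbonAlgebra K)}
    (hW : IsElementaryExcitationAtEnd W) {y : RibbonAlgebra K} (hy : y ∈ W) {x : C.Label}
    {u v : Idx x} (h : y (matrixUnit x u v) ≠ 0) (i : K ⧸ stabT x) (j : Fin (dimR x)) :
    SameCharge W (endBlock x i j) := by
  let θ : RibbonAlgebra K →ₗ[ℂ] RibbonAlgebra K :=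
    { toFun := actStart (matrixUnit x u (i, j))
      map_add' := fun _ _ => rfl
      map_smul' := fun _ _ => rfl }
  have hθ : ∀ w (a b : Idx x), θ w (matrixUnit x a b) =
      if (i, j) = a then w (matrixUnit x u b) else 0 := by
    intro w a b
    change w (matrixUnit x u (i, j) * matrixUnit x a b) = _
    rw [matrixUnit_mul, apply_ite w, map_zero]
  have hmem : ∀ w, θ w ∈ endBlock x i j := fun w => by
    refine (mem_endBlock_iff x (i, j) _).2 ⟨fun x' hx s t => ?_, fun s t hs => ?_⟩
    · change w (matrixUnit x u (i, j) * matrixUnit x' s t) = _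
      rw [matrixUnit_mul_of_ne hx.symm, map_zero]
    · rw [hθ, if_neg hs.symm]
  have hcomm : ∀ z w, θ (actEnd z w) = actEnd z (θ w) := fun z w => LinearMap.ext fun z' => by
    change w (_ * z' * z) = w (_ * (z' * z))
    rw [mul_assoc]
  let f : W →ₗ[ℂ] endBlock x i j := (θ.comp W.subtype).codRestrict _ fun w => hmem w
  have hinj : Function.Injective f := by
    rw [injective_iff_map_eq_zero]
    intro w hw
    have hw' : θ w = 0 := congrArg Subtype.val hw
    refine Subtype.ext (eq_zero_of_row hW hy h w.2 fun t => ?_)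
    have := hθ w (i, j) t
    rwa [hw', if_pos rfl, eq_comm] at this
  have hsurj : Function.Surjective f := by
    have hst : IsStableAtEnd (W.map θ) := by
      rintro z _ ⟨w, hw, rfl⟩
      exact ⟨actEnd z w, hW.2.1 z w hw, hcomm z w⟩
    have h0 : θ y ≠ 0 := fun h0 => h (by
      have := hθ y (i, j) v
      rwa [h0, if_pos rfl, eq_comm] at this)
    rintro ⟨w', hw'⟩
    obtain ⟨w, hw, rfl⟩ := endBlock_le hst (Submodule.mem_map_of_mem hy) (hmem y) h0 hw'
    exact ⟨⟨w, hw⟩, rfl⟩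
  refine ⟨LinearEquiv.ofBijective f ⟨hinj, hsurj⟩, fun z w w' hww' => ?_⟩
  change θ w' = actEnd z (θ w)
  rw [hww', hcomm]

/-- The idempotent `e_{vv}` of the label `x` fixes the nonzero element `e_{vv} ▷ y` of `W`, but it
annihilates the rows of every other label. -/
theorem eq_of_sameCharge_endBlock {W : Submodule ℂ (RibbonAlgebra K)} (hst : IsStableAtEnd W)
    {y : RibbonAlgebra K} (hy : y ∈ W) {x : C.Label} {u v : Idx x}
    (h : y (matrixUnit x u v) ≠ 0) {x' : C.Label} {i : K ⧸ stabT x'} {j : Fin (dimR x')}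
    (hW : SameCharge W (endBlock x' i j)) : x' = x := by
  obtain ⟨φ, hφ⟩ := hW
  by_contra hne
  let w : W := ⟨actEnd (matrixUnit x v v) y, hst _ y hy⟩
  have hw : (w : RibbonAlgebra K) = actEnd (matrixUnit x v v) w := LinearMap.ext fun z => by
    simp only [w, actEnd_apply, mul_assoc, matrixUnit_mul, if_true]
  have h0 : (φ w : RibbonAlgebra K) = 0 := by
    rw [hφ _ w w hw]
    refine LinearMap.ext fun z => ?_
    exact apply_mul_matrixUnit (fun s =>
      ((mem_endBlock_iff x' (i, j) _).1 (φ w).2).1 x (Ne.symm hne) s v) v z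
  have h1 : w = 0 := φ.injective (by rw [map_zero]; exact Subtype.ext h0)
  have h2 := LinearMap.congr_fun (congrArg Subtype.val h1) (matrixUnit x u v)
  simp only [w, actEnd_apply, matrixUnit_mul, if_true] at h2
  exact h h2

/-! ### The Fourier basis and dimensions -/

/-- Exchanging the representation indices is an injective reindexing of the dual units. -/
theorem linearIndependent_fourier (C : FourierChoice K) :
    LinearIndependent ℂ fun a : Σ x : C.Label, Idx x × Idx x => fourier a.1 a.2.1 a.2.2 :=
  (linearIndependent_dualUnit C).comp (fun a : Σ x : C.Label, Idx x × Idx x =>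
      (⟨a.1, (a.2.1.1, a.2.2.2), (a.2.2.1, a.2.1.2)⟩ : Σ x : C.Label, Idx x × Idx x)) <| by
    rintro ⟨x, p⟩ ⟨x', q⟩ h
    obtain rfl : x = x' := congrArg Sigma.fst h
    simp only [Sigma.mk.injEq, heq_eq_eq, Prod.mk.injEq, true_and] at h
    rw [show p = q from Prod.ext (Prod.ext h.1.1 h.2.2) (Prod.ext h.2.1 h.1.2)]

theorem span_fourier (C : FourierChoice K) :
    Submodule.span ℂ (Set.range fun a : Σ x : C.Label, Idx x × Idx x =>
      fourier a.1 a.2.1 a.2.2) = ⊤ := by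
  refine top_unique ((span_dualUnit C).ge.trans (Submodule.span_mono ?_))
  rintro _ ⟨⟨x, u, v⟩, rfl⟩
  exact ⟨⟨x, (u.1, v.2), (v.1, u.2)⟩, rfl⟩

theorem card_idx (x : C.Label) :
    Fintype.card (Idx x) = Nat.card (K ⧸ stabT x) * dimR x := by
  rw [Fintype.card_prod, Fintype.card_fin, Nat.card_eq_fintype_card]

theorem finrank_block (x : C.Label) :
    Module.finrank ℂ (block x) = (Nat.card (K ⧸ stabT x) * dimR x) ^ 2 := by
  have hli : LinearIndependent ℂ fun p : Idx x × Idx x => fourier x p.1 p.2 :=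
    (linearIndependent_fourier C).comp (Sigma.mk x) sigma_mk_injective
  rw [block, finrank_span_eq_card hli, Fintype.card_prod, card_idx, sq]

theorem finrank_endBlock (x : C.Label) (i : K ⧸ stabT x) (j : Fin (dimR x)) :
    Module.finrank ℂ (endBlock x i j) = Nat.card (K ⧸ stabT x) * dimR x := by
  -- By definition this family is the row `(i, j)` of dual units.
  have hli : LinearIndependent ℂ fun p : Idx x => fourier x (i, p.2) (p.1, j) :=
    (linearIndependent_dualUnit C).comp (fun p : Idx x => ⟨x, (i, j), p⟩) fun p q h => by
        simpa using h
  rw [endBlock, finrank_span_eq_card hli, card_idx]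

theorem quantumDim_block (x : C.Label) :
    quantumDim (block x) = (Nat.card (K ⧸ stabT x) : ℝ) * dimR x := by
  rw [quantumDim, finrank_block, Nat.cast_pow, Real.sqrt_sq (Nat.cast_nonneg _), Nat.cast_mul]

end FourierChoice
end Excitations
end KitaevBoundary
end

theorem mainTheorem1 {G : Type*} [Group G] [Fintype G] (K : Subgroup G) (C : FourierChoice K) :
    -- on every lattice, the local operators at a cilium represent `Z(G,1,K,1)` faithfully, and
    -- the ribbon operators on a boundary ribbon represent `Y(G,K)` faithfully
    (∀ {E : Type*},
      (∀ s : Cilium E, Function.Injective (localMap K s) ∧ localMap K s 1 = 1 ∧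
        ∀ z w, localMap K s (z * w) = localMap K s z * localMap K s w) ∧
      (∀ ρ : List (Triangle E), IsBoundaryRibbon ρ → Function.Injective (ribbonMap K ρ))) ∧
    -- the Fourier transformed ribbon operators are a basis of `Y(G,K)`
    (LinearIndependent ℂ (fun a : (Σ x : C.Label, FourierChoice.Idx x × FourierChoice.Idx x) =>
        FourierChoice.fourier a.1 a.2.1 a.2.2) ∧
      Submodule.span ℂ (Set.range fun a : (Σ x : C.Label, FourierChoice.Idx x × FourierChoice.Idx x) =>
        FourierChoice.fourier a.1 a.2.1 a.2.2) = ⊤) ∧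
    -- the elementary excitations are in bijection with the pairs `(T,R)`
    Set.BijOn (fun x : C.Label => FourierChoice.block x) Set.univ
      {W : Submodule ℂ (RibbonAlgebra K) | IsElementaryExcitation W} ∧
    -- the topological charges at one end of a ribbon are in bijection with the pairs `(T,R)`
    (∀ (x : C.Label) (i : K ⧸ FourierChoice.stabT x) (j' : Fin (FourierChoice.dimR x)),
      IsElementaryExcitationAtEnd (FourierChoice.endBlock x i j')) ∧
    (∀ W : Submodule ℂ (RibbonAlgebra K), IsElementaryExcitationAtEnd W →
      ∃ x : C.Label, (∀ i j', SameCharge W (FourierChoice.endBlock x i j')) ∧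
        ∀ x' : C.Label, (∃ i j', SameCharge W (FourierChoice.endBlock x' i j')) → x' = x) ∧
    -- the quantum dimension
    (∀ x : C.Label,
      quantumDim (FourierChoice.block x) =
          (Nat.card (K ⧸ FourierChoice.stabT x) : ℝ) * FourierChoice.dimR x ∧
      quantumDim (FourierChoice.block x) =
          (Nat.card K : ℝ) * FourierChoice.dimR x / Nat.card (FourierChoice.stabT x) ∧
      ∀ i j', Module.finrank ℂ (FourierChoice.endBlock x i j') =
          Nat.card (K ⧸ FourierChoice.stabT x) * FourierChoice.dimR x) := by
  refine ⟨fun {E} => ⟨fun s => ⟨localMap_injective s, localMap_one s, localMap_mul s⟩,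
    fun ρ hρ => ribbonMap_injective hρ⟩, ?_, ⟨?_, ?_, ?_⟩, ?_, ?_, ?_⟩
  · exact ⟨FourierChoice.linearIndependent_fourier C, FourierChoice.span_fourier C⟩
  · exact fun x _ => FourierChoice.block_isElementaryExcitation x
  · exact FourierChoice.block_injective.injOn
  · intro W hW
    obtain ⟨x, hx⟩ := FourierChoice.exists_eq_block C hW
    exact ⟨x, Set.mem_univ x, hx⟩
  · exact FourierChoice.endBlock_isElementaryExcitationAtEnd
  · intro W hW
    obtain ⟨y, hy, hy0⟩ := W.exists_mem_ne_zero_of_ne_bot hW.1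
    obtain ⟨x, u, v, h⟩ := FourierChoice.exists_matrixUnit_ne_zero C hy0
    refine ⟨x, FourierChoice.sameCharge_endBlock hW hy h, ?_⟩
    rintro x' ⟨i, j, hx'⟩
    exact FourierChoice.eq_of_sameCharge_endBlock hW.2.1 hy h hx'
  · intro x
    refine ⟨FourierChoice.quantumDim_block x, ?_, FourierChoice.finrank_endBlock x⟩
    have hcard : (Nat.card (FourierChoice.stabT x) : ℝ) ≠ 0 :=
      Nat.cast_ne_zero.2 Nat.card_pos.ne'
    rw [FourierChoice.quantumDim_block, eq_div_iff hcard,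
      Subgroup.card_eq_card_quotient_mul_card_subgroup (FourierChoice.stabT x), Nat.cast_mul]
    ring
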